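/- Let $n\ge 1$ be an integer. For $\alpha>0$ let $$\Phi_\alpha(x,t)=\frac{t^{\alpha-1}}{\Gamma(\alpha)}\,\frac{1}{(4\pi t)^{n/2}}\,e^{-|x|^2/(4t)}\quad (x\in\mathbb R^n,\ t>0),\qquad \Phi_\alpha(x,t)=0\quad (t\le 0).$$ For $p\ge 1$ let $X^p$ be the set of all measurable $f:\mathbb R^n\times\mathbb R\to\mathbb R$ with $f\in L^p(\mathbb R^n\times(-\infty,T))$ for every $T\in\mathbb R$, put $$J_\alpha f(x,t)=\iint_{\mathbb R^n\times(-\infty,t)}\Phi_\alpha(x-\xi,t-\tau)f(\xi,\tau)\,d\xi\,d\tau ,$$ the integral converging absolutely for almost every $(x,t)$, and let $Y^p_\alpha=J_\alpha(X^p)$. Functions are identified, and equalities and inequalities between them are understood, almost everywhere with respect to Lebesgue measure. Suppose that $$\Big(p>1\ \text{ and }\ 0<\alpha<\tfrac{n+2}{2p}\Big)\quad\text{or}\quad\Big(p=1\ \text{ and }\ 0<\alpha\le\tfrac{n+2}{2p}\Big),$$ and let $(\partial_t-\Delta)^\alpha:Y^p_\alpha\to X^p$ be the inverse of $J_\alpha:X^p\to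 Y^p_\alpha$, that is, $(\partial_t-\Delta)^\alpha u=f$ means that $f\in X^p$ and $u=J_\alpha f$. Let $\lambda>0$. Then the problem $$(\partial_t-\Delta)^\alpha u\ge u^\lambda\ \text{ in }\mathbb R^n\times\mathbb R,\qquad u=0\ \text{ in }\mathbb R^n\times(-\infty,0),$$ has a nonnegative solution $u\in Y^p_\alpha$ that is not almost everywhere zero if and only if $(\lambda,\alpha)\in B\cup D\cup E$, where $$B=\{(\lambda,\alpha):\lambda=1,\ \alpha>0\},$$ $$D=\Big\{(\lambda,\alpha):\lambda>1,\ \tfrac{n+2}{2p}\big(1-\tfrac1\lambda\big)\le\alpha<\tfrac{n+2}{2}\big(1-\tfrac1\lambda\big)\Big\},$$ $$E=\Big\{(\lambda,\alpha):\lambda>1,\ 0<\alpha<\tfrac{n+2}{2p}\big(1-\tfrac1\lambda\big)\Big\}.$$ -/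

import Mathlib

open MeasureTheory Real

noncomputable section

namespace FracHeat

/-- Space-time `ℝⁿ × ℝ`, with the Euclidean norm on `ℝⁿ` and Lebesgue measure as `volume`. -/
abbrev SpaceTime (n : ℕ) : Type := EuclideanSpace ℝ (Fin n) × ℝ

/-- The condition on `(α, p)` under which the fractional heat operator is defined:
`p > 1` and `0 < α < (n+2)/(2p)`, or `p = 1` and `0 < α ≤ (n+2)/(2p)`. -/
def Admissible (n : ℕ) (p α : ℝ) : Prop :=
  (1 < p ∧ 0 < α ∧ α < ((n : ℝ) + 2) / (2 * p)) ∨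
    (p = 1 ∧ 0 < α ∧ α ≤ ((n : ℝ) + 2) / (2 * p))

/-- The fractional heat kernel
`Φ_α(x,t) = t^(α-1) / Γ(α) * (4πt)^(-n/2) * exp(-|x|²/(4t))` for `t > 0`,
and `Φ_α(x,t) = 0` for `t ≤ 0`. -/
def Phi (n : ℕ) (α : ℝ) (x : EuclideanSpace ℝ (Fin n)) (t : ℝ) : ℝ :=
  if 0 < t then
    t ^ (α - 1) / Real.Gamma α * (1 / (4 * π * t) ^ ((n : ℝ) / 2)) *
      Real.exp (-‖x‖ ^ 2 / (4 * t))
  else 0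

/-- The half space `ℝⁿ × (-∞, T)`. -/
def past (n : ℕ) (T : ℝ) : Set (SpaceTime n) := {w | w.2 < T}

/-- `X^p`: the functions that lie in `L^p(ℝⁿ × (-∞, T))` for every real `T`. -/
def X (n : ℕ) (p : ℝ) : Set (SpaceTime n → ℝ) :=
  {f | ∀ T : ℝ, MemLp f (ENNReal.ofReal p) (volume.restrict (past n T))}

/-- The integrand `(ξ,τ) ↦ Φ_α(x-ξ, t-τ) f(ξ,τ)` of `J_α f` at the point `z = (x,t)`. -/
def jIntegrand (n : ℕ) (α : ℝ) (f : SpaceTime n → ℝ) (z w : SpaceTime n) : ℝ :=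
  Phi n α (z.1 - w.1) (z.2 - w.2) * f w

/-- `J_α f (x,t) = ∬_{ℝⁿ × (-∞,t)} Φ_α(x-ξ, t-τ) f(ξ,τ) dξ dτ`. -/
def J (n : ℕ) (α : ℝ) (f : SpaceTime n → ℝ) (z : SpaceTime n) : ℝ :=
  ∫ w in past n z.2, jIntegrand n α f z w

/-- The function `u` is `J_α f`: at almost every point the integral that defines `J_α f`
converges absolutely and its value is that of `u`. Functions are, as usual for `L^p` classes,
identified when they agree almost everywhere. -/
def IsJ (n : ℕ) (α : ℝ) (f u : SpaceTime n → ℝ) : Prop :=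
  ∀ᵐ z : SpaceTime n,
    IntegrableOn (jIntegrand n α f z) (past n z.2) volume ∧ u z = J n α f z

/-- `Y^p_α = J_α(X^p)`. -/
def Y (n : ℕ) (p α : ℝ) : Set (SpaceTime n → ℝ) :=
  {u | ∃ f ∈ X n p, IsJ n α f u}

/-- `(∂_t - Δ)^α u = f`, for the fractional heat operator `(∂_t - Δ)^α : Y^p_α → X^p`,
which is the inverse of `J_α : X^p → Y^p_α`: this is its graph, i.e. the
graph of `J_α` on `X^p` with the two coordinates exchanged. -/
def FracHeatEq (n : ℕ) (p α : ℝ) (u f : SpaceTime n → ℝ) : Prop :=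
  f ∈ X n p ∧ IsJ n α f u

/-- `u ∈ Y^p_α` is a nonnegative solution of the super problem
`(∂_t - Δ)^α u ≥ u^lam` in `ℝⁿ × ℝ`, `u = 0` in `ℝⁿ × (-∞, 0)`. -/
structure IsNonnegSuperSolution (n : ℕ) (p α lam : ℝ) (u : SpaceTime n → ℝ) : Prop where
  mem : u ∈ Y n p α
  nonneg : ∀ᵐ z : SpaceTime n, 0 ≤ u z
  super : ∃ f : SpaceTime n → ℝ, FracHeatEq n p α u f ∧ ∀ᵐ z : SpaceTime n, u z ^ lam ≤ f z
  initial : ∀ᵐ z : SpaceTime n, z.2 < 0 → u z = 0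

/-- The region `B` of the `(lam, α)`-plane. -/
def regionB : Set (ℝ × ℝ) := {q | q.1 = 1 ∧ 0 < q.2}

/-- The region `D` of the `(lam, α)`-plane. -/
def regionD (n : ℕ) (p : ℝ) : Set (ℝ × ℝ) :=
  {q | 1 < q.1 ∧ ((n : ℝ) + 2) / (2 * p) * (1 - 1 / q.1) ≤ q.2 ∧
    q.2 < ((n : ℝ) + 2) / 2 * (1 - 1 / q.1)}

/-- The region `E` of the `(lam, α)`-plane. -/
def regionE (n : ℕ) (p : ℝ) : Set (ℝ × ℝ) :=
  {q | 1 < q.1 ∧ 0 < q.2 ∧ q.2 < ((n : ℝ) + 2) / (2 * p) * (1 - 1 / q.1)}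

end FracHeat

end

/-! Writing `F` for the right-hand side `f`, which is nonnegative since `f ≥ u ^ lam`, turns the
problem into the integral inequality `F ≥ (J_α F) ^ lam` for a nonzero `F` with values in `[0, ∞]`.
Admissibility gives `α ≤ (n+2)/2`, so the power `α - 1 - n/2` of time in the kernel is nonpositive
and the kernel is easy to bound below.

If `lam < 1`, a lower bound `ε exp(-K/(t-a))` on a ball passes to the ball of radius one larger with
the same `ε` and `K` (`strip_step`). Hence `F` is bounded below on a whole strip, which has infinite
measure, against `f ∈ X^p` (`exists_strip_of_lt_one`).

If `lam > 1` and `2 α lam ≥ (n+2)(lam-1)`, the mass of `F` on the cylinder of radius `R` forces a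
new mass of at least a constant times its power `lam` on a later, disjoint cylinder
(`mass_two_mul`). So the mass is unbounded as `R` grows, and once it is large enough, an iteration
over shrinking time steps makes `F` infinite on a set of positive measure (`eq_top_of_large`).

In the remaining cases a solution is built from `f = h(t) G(x, t+1)` with `G` the heat kernel. By
the semigroup property `J_α` then acts on `h` alone, as a fractional integral in time
(`potential_profile`). The choices are `h = exp` for `lam = 1` and a small multiple of a power of `1
+ t` for `lam > 1`. The exponent `p` drops out because the curve separating `D` from `E` lies on or
below the critical one. -/

namespace FracHeat

open Set ENNReal

/-! ### Lower bounds for the kernel and the potential -/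

/-- The volume of the unit ball of `ℝⁿ`. -/
noncomputable def ballVol (n : ℕ) : ℝ :=
  (volume (Metric.ball (0 : EuclideanSpace ℝ (Fin n)) 1)).toReal

lemma ballVol_pos (n : ℕ) : 0 < ballVol n :=
  ENNReal.toReal_pos (Metric.measure_ball_pos _ _ one_pos).ne' measure_ball_lt_top.ne

lemma volume_cylinder (n : ℕ) (x : EuclideanSpace ℝ (Fin n)) {r : ℝ} (hr : 0 < r) (a b : ℝ) :
    (volume : Measure (SpaceTime n)) (Metric.ball x r ×ˢ Ioo a b) =
      ENNReal.ofReal (r ^ n * ballVol n * (b - a)) := by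
  rw [Measure.volume_eq_prod, Measure.prod_prod, Measure.addHaar_ball_of_pos _ _ hr, Real.volume_Ioo,
    finrank_euclideanSpace, Fintype.card_fin, ENNReal.ofReal_mul
      (mul_nonneg (pow_nonneg hr.le n) (ballVol_pos n).le), ENNReal.ofReal_mul (pow_nonneg hr.le n),
    ballVol, ENNReal.ofReal_toReal measure_ball_lt_top.ne]

/-- The constant `1 / (Γ(α) (4π)^(n/2))` in the fractional heat kernel. -/
noncomputable def kernelConst (n : ℕ) (α : ℝ) : ℝ :=
  1 / (Real.Gamma α * (4 * π) ^ ((n : ℝ) / 2))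

lemma kernelConst_pos (n : ℕ) {α : ℝ} (hα : 0 < α) : 0 < kernelConst n α := by
  have := Real.Gamma_pos_of_pos hα
  unfold kernelConst
  positivity

lemma Phi_of_pos (n : ℕ) (α : ℝ) (x : EuclideanSpace ℝ (Fin n)) {t : ℝ} (ht : 0 < t) :
    Phi n α x t =
      kernelConst n α * t ^ (α - 1 - (n : ℝ) / 2) * Real.exp (-(‖x‖ ^ 2 / (4 * t))) := by
  rw [Phi, if_pos ht, kernelConst, Real.mul_rpow (by positivity) ht.le,
    Real.rpow_sub ht (α - 1) ((n : ℝ) / 2), neg_div]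
  ring

lemma Phi_nonneg (n : ℕ) {α : ℝ} (hα : 0 < α) (x : EuclideanSpace ℝ (Fin n)) (t : ℝ) :
    0 ≤ Phi n α x t := by
  rcases lt_or_ge 0 t with ht | ht
  · rw [Phi_of_pos n α x ht]
    have := kernelConst_pos n hα
    positivity
  · rw [Phi, if_neg ht.not_gt]

/-- By `hαn` the power of time is nonincreasing, so it is smallest at `T`; `hx` caps the Gaussian
exponent by `K`. -/
lemma le_Phi (n : ℕ) {α : ℝ} (hα : 0 < α) (hαn : α ≤ ((n : ℝ) + 2) / 2) {s T K : ℝ}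
    (hs : 0 < s) (hsT : s ≤ T) (x : EuclideanSpace ℝ (Fin n)) (hx : ‖x‖ ^ 2 ≤ 4 * K * s) :
    kernelConst n α * T ^ (α - 1 - (n : ℝ) / 2) * Real.exp (-K) ≤ Phi n α x s := by
  rw [Phi_of_pos n α x hs]
  have h1 := kernelConst_pos n hα
  have h2 : T ^ (α - 1 - (n : ℝ) / 2) ≤ s ^ (α - 1 - (n : ℝ) / 2) :=
    Real.rpow_le_rpow_of_nonpos hs hsT (by linarith)
  have h3 : ‖x‖ ^ 2 / (4 * s) ≤ K := by
    rw [div_le_iff₀ (by positivity)]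
    linarith
  gcongr

/-- The operator `J_α` on functions with values in `[0, ∞]`. -/
noncomputable def potential (n : ℕ) (α : ℝ) (F : SpaceTime n → ℝ≥0∞) (z : SpaceTime n) : ℝ≥0∞ :=
  ∫⁻ w, ENNReal.ofReal (Phi n α (z.1 - w.1) (z.2 - w.2)) * F w

lemma mul_setLIntegral_le_potential {n : ℕ} {α : ℝ} {F : SpaceTime n → ℝ≥0∞} {z : SpaceTime n}
    {S : Set (SpaceTime n)} (hS : MeasurableSet S) {k : ℝ}
    (hk : ∀ w ∈ S, k ≤ Phi n α (z.1 - w.1) (z.2 - w.2)) :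
    ENNReal.ofReal k * ∫⁻ w in S, F w ≤ potential n α F z := by
  rw [← lintegral_const_mul' _ _ ENNReal.ofReal_ne_top]
  refine le_trans ?_ (setLIntegral_le_lintegral S _)
  refine lintegral_mono_ae ((ae_restrict_iff' hS).2 (.of_forall fun w hw => ?_))
  gcongr
  exact hk w hw

/-- Lower bound for the potential at a point of `B(0, R + d)` of a function that is bounded below
on `B(0, R)` during an earlier time interval. -/
lemma le_potential_of_cylinder {n : ℕ} {α : ℝ} (hα : 0 < α) (hαn : α ≤ ((n : ℝ) + 2) / 2)
    {F : SpaceTime n → ℝ≥0∞} {R d r t₁ t₂ t m K : ℝ} (hr : 0 < r) (hrR : r ≤ R) (hd : 0 ≤ d)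
    (hm : 0 ≤ m) (ht₂ : t₂ < t) (ht₁ : t₁ < t₂)
    (hK : (d + 2 * r) ^ 2 ≤ 4 * K * (t - t₂))
    (hF : ∀ᵐ w : SpaceTime n, w ∈ Metric.ball (0 : EuclideanSpace ℝ (Fin n)) R ×ˢ Ioo t₁ t₂ →
      ENNReal.ofReal m ≤ F w)
    {x : EuclideanSpace ℝ (Fin n)} (hx : x ∈ Metric.ball 0 (R + d)) :
    ENNReal.ofReal ((kernelConst n α * (t - t₁) ^ (α - 1 - (n : ℝ) / 2) * Real.exp (-K)) *
      (m * (r ^ n * ballVol n * (t₂ - t₁)))) ≤ potential n α F (x, t) := by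
  have hRd : 0 < R + d := by linarith
  -- Scaling `x` towards the origin puts the ball of radius `r` about `y` inside `B(0, R)`, with all
  -- its points within `d + 2r` of `x`.
  set y : EuclideanSpace ℝ (Fin n) := ((R - r) / (R + d)) • x with hy
  have hxn : ‖x‖ < R + d := by simpa using hx
  have hyn : ‖y‖ ≤ R - r := by
    rw [hy, norm_smul, Real.norm_eq_abs, abs_of_nonneg (div_nonneg (by linarith) hRd.le)]
    calc (R - r) / (R + d) * ‖x‖ ≤ (R - r) / (R + d) * (R + d) := by
          gcongr
      _ = R - r := by field_simp
  have hxy : ‖x - y‖ ≤ d + r := by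
    have : x - y = ((d + r) / (R + d)) • x := by
      have h1 : x - y = (1 - (R - r) / (R + d)) • x := by rw [hy, sub_smul, one_smul]
      rw [h1]
      congr 1
      field_simp
      ring
    rw [this, norm_smul, Real.norm_eq_abs, abs_of_nonneg (by positivity)]
    calc (d + r) / (R + d) * ‖x‖ ≤ (d + r) / (R + d) * (R + d) := by gcongr
      _ = d + r := by field_simp
  have hsub : Metric.ball y r ⊆ Metric.ball 0 R := by
    intro ξ hξ
    have h1 : ‖ξ - y‖ < r := by simpa [dist_eq_norm] using hξ
    have h2 : ‖ξ‖ ≤ ‖ξ - y‖ + ‖y‖ := by simpa using norm_add_le (ξ - y) y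
    simp only [Metric.mem_ball, dist_zero_right]
    linarith
  have hS : MeasurableSet (Metric.ball y r ×ˢ Ioo t₁ t₂ : Set (SpaceTime n)) :=
    measurableSet_ball.prod measurableSet_Ioo
  refine le_trans ?_ (mul_setLIntegral_le_potential hS
    (k := kernelConst n α * (t - t₁) ^ (α - 1 - (n : ℝ) / 2) * Real.exp (-K)) ?_)
  · have hc := kernelConst_pos n hα
    have ht : 0 < t - t₁ := by linarith
    rw [ENNReal.ofReal_mul (by positivity)]
    gcongr
    rw [ENNReal.ofReal_mul hm, ← volume_cylinder n y hr, ← setLIntegral_const]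
    refine lintegral_mono_ae ((ae_restrict_iff' hS).2 ?_)
    filter_upwards [hF] with w hw hwS
    exact hw ⟨hsub hwS.1, hwS.2⟩
  · rintro ⟨ξ, τ⟩ ⟨hξ, hτ⟩
    simp only [mem_Ioo] at hτ hξ ⊢
    have hτ' : 0 < t - t₂ := by linarith
    have h1 : ‖y - ξ‖ < r := by simpa [dist_eq_norm, norm_sub_rev] using hξ
    have h2 : ‖x - ξ‖ ≤ ‖x - y‖ + ‖y - ξ‖ := by simpa using norm_add_le (x - y) (y - ξ)
    have h3 : ‖x - ξ‖ ^ 2 ≤ (d + 2 * r) ^ 2 := by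
      have : ‖x - ξ‖ ≤ d + 2 * r := by linarith
      gcongr
    have hK0 : 0 ≤ K := by
      by_contra hneg
      nlinarith [sq_nonneg (d + 2 * r)]
    refine le_Phi n hα hαn (by linarith [hτ.2]) (by linarith [hτ.1]) _ ?_
    nlinarith [hτ.2]

/-! ### Mass on parabolic cylinders -/

/-- The integral of `F` over the parabolic cylinder `B(0,R) × (-R², R²)`. -/
noncomputable def mass {n : ℕ} (F : SpaceTime n → ℝ≥0∞) (R : ℝ) : ℝ≥0∞ :=
  ∫⁻ w in Metric.ball (0 : EuclideanSpace ℝ (Fin n)) R ×ˢ Ioo (-R ^ 2) (R ^ 2), F w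

/-- The constant in the lower bound of the potential by the mass of a cylinder. -/
noncomputable def massConst (n : ℕ) (α : ℝ) : ℝ :=
  kernelConst n α * 4 ^ (α - 1 - (n : ℝ) / 2) * Real.exp (-1)

lemma massConst_pos (n : ℕ) {α : ℝ} (hα : 0 < α) : 0 < massConst n α := by
  have := kernelConst_pos n hα
  unfold massConst
  positivity

/-- The time lag lies between `R²` and `4R²` and the spatial distance is below `2R`, so the Gaussian
factor is at least `exp(-1)`. -/
lemma le_potential_of_mass {n : ℕ} {α : ℝ} (hα : 0 < α) (hαn : α ≤ ((n : ℝ) + 2) / 2)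
    (F : SpaceTime n → ℝ≥0∞) {R : ℝ} (hR : 0 < R) {z : SpaceTime n}
    (hz : z ∈ Metric.ball (0 : EuclideanSpace ℝ (Fin n)) R ×ˢ Ioo (2 * R ^ 2) (3 * R ^ 2)) :
    ENNReal.ofReal (massConst n α * R ^ (2 * α - n - 2)) * mass F R ≤ potential n α F z := by
  refine mul_setLIntegral_le_potential (measurableSet_ball.prod measurableSet_Ioo) ?_
  rintro ⟨ξ, τ⟩ ⟨hξ, hτ⟩
  obtain ⟨hx, ht⟩ := hz
  simp only [mem_Ioo, Metric.mem_ball, dist_zero_right] at hξ hτ hx ht ⊢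
  have hR2 : 0 < R ^ 2 := by positivity
  have h := le_Phi n hα hαn (s := z.2 - τ) (T := 4 * R ^ 2) (K := 1) (by linarith) (by linarith)
    (z.1 - ξ) (by
      have h1 : ‖z.1 - ξ‖ ≤ 2 * R := (norm_sub_le _ _).trans (by linarith)
      have h2 : ‖z.1 - ξ‖ ^ 2 ≤ (2 * R) ^ 2 := by gcongr
      nlinarith)
  refine le_trans (le_of_eq ?_) h
  rw [massConst, Real.mul_rpow (by norm_num) hR2.le, ← Real.rpow_natCast R 2,
    ← Real.rpow_mul hR.le]
  have : ((2 : ℕ) : ℝ) * (α - 1 - (n : ℝ) / 2) = 2 * α - n - 2 := by push_cast; ring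
  rw [this]
  ring

/-- A function `F ≥ (J_α F)^lam` is bounded below at later times by the mass of a cylinder. -/
lemma le_of_mass {n : ℕ} {α lam : ℝ} (hα : 0 < α) (hαn : α ≤ ((n : ℝ) + 2) / 2) (hlam : 0 < lam)
    {F : SpaceTime n → ℝ≥0∞} (hF : ∀ᵐ z, potential n α F z ^ lam ≤ F z) {R : ℝ} (hR : 0 < R) :
    ∀ᵐ z : SpaceTime n,
      z ∈ Metric.ball (0 : EuclideanSpace ℝ (Fin n)) R ×ˢ Ioo (2 * R ^ 2) (3 * R ^ 2) →
      (ENNReal.ofReal (massConst n α * R ^ (2 * α - n - 2)) * mass F R) ^ lam ≤ F z := by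
  filter_upwards [hF] with z hz hzS
  exact le_trans (ENNReal.rpow_le_rpow (le_potential_of_mass hα hαn F hR hzS) hlam.le) hz

lemma exists_mass_pos {n : ℕ} {F : SpaceTime n → ℝ≥0∞} (hFm : AEMeasurable F)
    (hF0 : ¬ (F =ᵐ[volume] 0)) : ∃ R, 1 ≤ R ∧ 0 < mass F R := by
  by_contra! h
  refine hF0 ?_
  have hcov : (⋃ k : ℕ, Metric.ball (0 : EuclideanSpace ℝ (Fin n)) (k + 1) ×ˢ
      Ioo (-((k : ℝ) + 1) ^ 2) (((k : ℝ) + 1) ^ 2)) = (univ : Set (SpaceTime n)) := by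
    refine eq_univ_of_forall fun w => mem_iUnion.2 ?_
    obtain ⟨k, hk⟩ := exists_nat_ge (max ‖w.1‖ |w.2|)
    have h1 := (le_max_left _ _).trans hk
    have h2 := abs_le.1 ((le_max_right _ _).trans hk)
    have hk0 : (0 : ℝ) ≤ k := k.cast_nonneg
    refine ⟨k, ?_, ?_, ?_⟩
    · simp only [Metric.mem_ball, dist_zero_right]
      linarith
    · nlinarith
    · nlinarith
  rw [← Measure.restrict_univ (μ := (volume : Measure (SpaceTime n))), ← hcov]
  refine (ae_restrict_iUnion_iff _ _).2 fun k => ?_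
  exact (lintegral_eq_zero_iff' hFm.restrict).1
    (nonpos_iff_eq_zero.1 (h ((k : ℝ) + 1) (by linarith [(k.cast_nonneg : (0 : ℝ) ≤ k)])))

/-! ### Iteration in time and blow-up -/

/-- The constant in the lower bound of the potential on a cylinder after a short time. -/
noncomputable def stepConst (n : ℕ) (α : ℝ) : ℝ :=
  kernelConst n α * Real.exp (-1) * ballVol n / 2 ^ (n + 1)

lemma stepConst_pos (n : ℕ) {α : ℝ} (hα : 0 < α) : 0 < stepConst n α := by
  have := kernelConst_pos n hα
  have := ballVol_pos n
  unfold stepConst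
  positivity

/-- Only the window `(t-δ, t-δ/2)` and a ball of parabolic radius `√δ/2` are used. The factor
`δ^(n/2)` of the ball cancels the one in the kernel and leaves `δ^α`; with `d = 0` the radius `R` is
kept. -/
lemma cylinder_step {n : ℕ} {α lam : ℝ} (hα : 0 < α) (hαn : α ≤ ((n : ℝ) + 2) / 2)
    (hlam : 0 < lam) {F : SpaceTime n → ℝ≥0∞} (hF : ∀ᵐ z, potential n α F z ^ lam ≤ F z)
    {R m δ a b : ℝ} (hR : 0 < R) (hm : 0 ≤ m) (hδ : 0 < δ) (hδR : δ ≤ R ^ 2)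
    (hFm : ∀ᵐ w : SpaceTime n, w ∈ Metric.ball (0 : EuclideanSpace ℝ (Fin n)) R ×ˢ Ioo a b →
      ENNReal.ofReal m ≤ F w) :
    ∀ᵐ w : SpaceTime n, w ∈ Metric.ball (0 : EuclideanSpace ℝ (Fin n)) R ×ˢ Ioo (a + δ) b →
      ENNReal.ofReal ((stepConst n α * δ ^ α * m) ^ lam) ≤ F w := by
  have hc := stepConst_pos n hα
  filter_upwards [hF] with w hw hwS
  obtain ⟨hx, ht⟩ := hwS
  simp only [mem_Ioo] at ht
  refine le_trans ?_ hw
  rw [← ENNReal.ofReal_rpow_of_nonneg (by positivity) hlam.le]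
  refine ENNReal.rpow_le_rpow ?_ hlam.le
  have hsq : √δ ^ 2 = δ := Real.sq_sqrt hδ.le
  have hs : √δ ≤ R := (Real.sqrt_le_left hR.le).2 hδR
  have hs0 : 0 < √δ := Real.sqrt_pos.2 hδ
  have h := le_potential_of_cylinder (F := F) hα hαn (R := R) (d := 0) (r := √δ / 2)
    (t₁ := w.2 - δ) (t₂ := w.2 - δ / 2) (t := w.2) (m := m) (K := 1) (by positivity) (by linarith)
    le_rfl hm (by linarith) (by linarith) (by nlinarith) (by
      filter_upwards [hFm] with v hv hvS
      refine hv ⟨hvS.1, ?_, ?_⟩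
      · linarith [hvS.2.1]
      · linarith [hvS.2.2]) (x := w.1) (by simpa using hx)
  refine le_trans (ENNReal.ofReal_le_ofReal (le_of_eq ?_)) h
  have h1 : √δ ^ n = δ ^ ((n : ℝ) / 2) := by
    rw [Real.sqrt_eq_rpow, ← Real.rpow_natCast, ← Real.rpow_mul hδ.le]
    congr 1
    ring
  have h2 : δ ^ α = δ ^ (α - 1 - (n : ℝ) / 2) * δ ^ ((n : ℝ) / 2) * δ := by
    rw [← Real.rpow_add hδ, ← Real.rpow_add_one hδ.ne']
    congr 1
    ring
  rw [stepConst, h2, div_pow, h1, show w.2 - (w.2 - δ) = δ by ring,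
    show w.2 - δ / 2 - (w.2 - δ) = δ / 2 by ring, pow_succ]
  field_simp

/-- For `lam > 1`, a function `F ≥ (J_α F)^lam` that is sufficiently large on a cylinder is
infinite on a part of it. -/
lemma eq_top_of_large {n : ℕ} {α lam : ℝ} (hα : 0 < α) (hαn : α ≤ ((n : ℝ) + 2) / 2)
    (hlam : 1 < lam) {F : SpaceTime n → ℝ≥0∞} (hF : ∀ᵐ z, potential n α F z ^ lam ≤ F z)
    {R m L a : ℝ} (hR : 0 < R) (hm : 0 < m) (hL : 0 < L) (hLR : L ≤ R ^ 2)
    (hlarge : ((2 : ℝ) ^ (α / (lam - 1))) ^ lam ≤ stepConst n α * L ^ α * m ^ (lam - 1))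
    (hFm : ∀ᵐ w : SpaceTime n,
      w ∈ Metric.ball (0 : EuclideanSpace ℝ (Fin n)) R ×ˢ Ioo a (a + 2 * L) →
      ENNReal.ofReal (m ^ lam) ≤ F w) :
    ∀ᵐ w : SpaceTime n,
      w ∈ Metric.ball (0 : EuclideanSpace ℝ (Fin n)) R ×ˢ Ioo (a + L) (a + 2 * L) →
      F w = ∞ := by
  have hl1 : 0 < lam - 1 := by linarith
  have hl0 : 0 < lam := by linarith
  have hc := stepConst_pos n hα
  -- Halving the time step costs a factor `2^α = B^(lam-1)`, which growth of the lower bound by `B`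
  -- per step compensates. The steps `L/2^(k+1)` sum to `L`, so every bound holds after time `a +
  -- L`.
  set B : ℝ := 2 ^ (α / (lam - 1)) with hB
  have hB1 : 1 < B := Real.one_lt_rpow one_lt_two (by positivity)
  have hB0 : 0 < B := by linarith
  have h2B : (2 : ℝ) ^ α = B ^ (lam - 1) := by
    rw [hB, ← Real.rpow_mul (by norm_num)]
    congr 1
    field_simp
  have key : ∀ k : ℕ, ∀ᵐ w : SpaceTime n, w ∈ Metric.ball (0 : EuclideanSpace ℝ (Fin n)) R ×ˢ
      Ioo (a + L * (1 - 1 / 2 ^ k)) (a + 2 * L) → ENNReal.ofReal ((m * B ^ k) ^ lam) ≤ F w := by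
    intro k
    induction k with
    | zero => simpa using hFm
    | succ k ih =>
      have hδ : L / 2 ^ (k + 1) ≤ R ^ 2 :=
        (div_le_self hL.le (one_le_pow₀ one_le_two)).trans hLR
      have h := cylinder_step hα hαn hl0 hF hR (by positivity) (by positivity) hδ ih
      have hgrow : m * B ^ (k + 1) ≤
          stepConst n α * (L / 2 ^ (k + 1)) ^ α * (m * B ^ k) ^ lam := by
        have e1 : (L / 2 ^ (k + 1)) ^ α = L ^ α / B ^ ((lam - 1) * (k + 1)) := by
          rw [Real.div_rpow hL.le (by positivity), ← Real.rpow_natCast 2 (k + 1),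
            ← Real.rpow_mul (by norm_num), mul_comm _ α, Real.rpow_mul (by norm_num), h2B,
            ← Real.rpow_mul hB0.le]
          push_cast
          rfl
        have e2 : (m * B ^ k) ^ lam = m ^ (lam - 1) * m * B ^ (k * lam) := by
          rw [Real.mul_rpow hm.le (by positivity), ← Real.rpow_add_one hm.ne',
            Real.rpow_mul hB0.le, Real.rpow_natCast]
          congr 2
          ring
        have e3 : m * B ^ (k + 1) =
            B ^ lam * (m * B ^ (k * lam) / B ^ ((lam - 1) * (k + 1))) := by
          have : B ^ (k + 1) * B ^ ((lam - 1) * (k + 1)) = B ^ lam * B ^ (k * lam) := by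
            rw [← Real.rpow_natCast B (k + 1), ← Real.rpow_add hB0, ← Real.rpow_add hB0]
            congr 1
            push_cast
            ring
          field_simp
          exact this
        calc m * B ^ (k + 1) = B ^ lam * (m * B ^ (k * lam) / B ^ ((lam - 1) * (k + 1))) := e3
          _ ≤ (stepConst n α * L ^ α * m ^ (lam - 1)) *
              (m * B ^ (k * lam) / B ^ ((lam - 1) * (k + 1))) := by gcongr
          _ = _ := by rw [e1, e2]; ring
      filter_upwards [h] with w hw hwS
      refine le_trans (ENNReal.ofReal_le_ofReal ?_) (hw ⟨hwS.1, ?_, hwS.2.2⟩)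
      · gcongr
      · refine lt_of_eq_of_lt ?_ hwS.2.1
        rw [pow_succ]
        field_simp
        ring
  filter_upwards [ae_all_iff.2 key] with w hw hwS
  have hw' : ∀ k : ℕ, ENNReal.ofReal ((m * B ^ k) ^ lam) ≤ F w := fun k =>
    hw k ⟨hwS.1, lt_of_le_of_lt (by
      have : (0 : ℝ) < 1 / 2 ^ k := by positivity
      nlinarith) hwS.2.1, hwS.2.2⟩
  have hlim : Filter.Tendsto (fun k : ℕ => ENNReal.ofReal ((m * B ^ k) ^ lam)) Filter.atTop
      (nhds ∞) :=
    ENNReal.tendsto_ofReal_atTop.comp ((tendsto_rpow_atTop hl0).comp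
      ((tendsto_pow_atTop_atTop_of_one_lt hB1).const_mul_atTop hm))
  exact top_le_iff.1 (le_of_tendsto' hlim hw')

/-! ### Growth of the mass and nonexistence for `lam > 1` -/

lemma mass_mono {n : ℕ} (F : SpaceTime n → ℝ≥0∞) {R S : ℝ} (hR : 0 ≤ R) (hRS : R ≤ S) :
    mass F R ≤ mass F S := by
  have h : R ^ 2 ≤ S ^ 2 := by gcongr
  exact lintegral_mono_set
    (prod_mono (Metric.ball_subset_ball hRS) (Ioo_subset_Ioo (by linarith) h))

/-- Below the critical line the mass grows by a fixed power when the radius doubles. -/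
lemma mass_two_mul {n : ℕ} {α lam : ℝ} (hα : 0 < α) (hαn : α ≤ ((n : ℝ) + 2) / 2)
    (hlam : 0 < lam) (hcrit : ((n : ℝ) + 2) * (lam - 1) ≤ 2 * α * lam)
    {F : SpaceTime n → ℝ≥0∞} (hF : ∀ᵐ z, potential n α F z ^ lam ≤ F z) {R : ℝ} (hR : 1 ≤ R) :
    mass F R + ENNReal.ofReal (massConst n α ^ lam * ballVol n) * mass F R ^ lam ≤
      mass F (2 * R) := by
  have hR0 : 0 < R := by linarith
  have hR2 : 0 < R ^ 2 := by positivity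
  have hc := massConst_pos n hα
  have hv := ballVol_pos n
  set Q : Set (SpaceTime n) := Metric.ball 0 R ×ˢ Ioo (-R ^ 2) (R ^ 2)
  set Q' : Set (SpaceTime n) := Metric.ball 0 R ×ˢ Ioo (2 * R ^ 2) (3 * R ^ 2)
  have hQ' : MeasurableSet Q' := measurableSet_ball.prod measurableSet_Ioo
  have hdisj : Disjoint Q Q' := by
    refine disjoint_left.2 fun w hw hw' => ?_
    linarith [hw.2.2, hw'.2.1]
  have hsub : Q ∪ Q' ⊆ Metric.ball 0 (2 * R) ×ˢ Ioo (-(2 * R) ^ 2) ((2 * R) ^ 2) := by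
    have hb : Metric.ball (0 : EuclideanSpace ℝ (Fin n)) R ⊆ Metric.ball 0 (2 * R) :=
      Metric.ball_subset_ball (by linarith)
    refine union_subset (prod_mono hb (Ioo_subset_Ioo ?_ ?_))
      (prod_mono hb (Ioo_subset_Ioo ?_ ?_)) <;> nlinarith
  refine le_trans ?_ (lintegral_mono_set hsub)
  rw [lintegral_union hQ' hdisj]
  refine add_le_add le_rfl ?_
  have hvol : volume Q' = ENNReal.ofReal (R ^ n * ballVol n * R ^ 2) := by
    rw [volume_cylinder n 0 hR0]
    congr 2
    ring
  have hconst : ENNReal.ofReal (massConst n α ^ lam * ballVol n) * mass F R ^ lam ≤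
      (ENNReal.ofReal (massConst n α * R ^ (2 * α - n - 2)) * mass F R) ^ lam * volume Q' := by
    rw [ENNReal.mul_rpow_of_nonneg _ _ hlam.le, hvol, mul_right_comm,
      ENNReal.ofReal_rpow_of_nonneg (by positivity) hlam.le,
      ← ENNReal.ofReal_mul (by positivity)]
    refine mul_le_mul_left (ENNReal.ofReal_le_ofReal ?_) _
    have e : (massConst n α * R ^ (2 * α - n - 2)) ^ lam * (R ^ n * ballVol n * R ^ 2) =
        massConst n α ^ lam * ballVol n * R ^ ((2 * α - n - 2) * lam + (n + 2)) := by
      rw [Real.mul_rpow hc.le (by positivity), ← Real.rpow_mul hR0.le, Real.rpow_add hR0,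
        Real.rpow_add hR0, Real.rpow_natCast, Real.rpow_two]
      ring
    rw [e]
    -- The exponent equals `2 α lam - (n+2)(lam-1)`, nonnegative by `hcrit`.
    exact le_mul_of_one_le_right (by positivity) (Real.one_le_rpow hR (by nlinarith))
  refine hconst.trans ?_
  rw [← setLIntegral_const]
  exact lintegral_mono_ae ((ae_restrict_iff' hQ').2 (le_of_mass hα hαn hlam hF hR0))

/-- Below the critical line the mass is unbounded. -/
lemma exists_mass_ge {n : ℕ} {α lam : ℝ} (hα : 0 < α) (hαn : α ≤ ((n : ℝ) + 2) / 2)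
    (hlam : 0 < lam) (hcrit : ((n : ℝ) + 2) * (lam - 1) ≤ 2 * α * lam)
    {F : SpaceTime n → ℝ≥0∞} (hFm : AEMeasurable F) (hF0 : ¬ (F =ᵐ[volume] 0))
    (hF : ∀ᵐ z, potential n α F z ^ lam ≤ F z) (A : ℝ) :
    ∃ R, 1 ≤ R ∧ ENNReal.ofReal A ≤ mass F R := by
  obtain ⟨R, hR, hpos⟩ := exists_mass_pos hFm hF0
  obtain ⟨a, ha, haR⟩ : ∃ a : ℝ, 0 < a ∧ ENNReal.ofReal a ≤ mass F R := by
    rcases eq_or_ne (mass F R) ∞ with h | h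
    · exact ⟨1, one_pos, h ▸ le_top⟩
    · exact ⟨(mass F R).toReal, ENNReal.toReal_pos hpos.ne' h, (ENNReal.ofReal_toReal h).le⟩
  set c := massConst n α ^ lam * ballVol n with hc
  have hc0 : 0 < c := by
    have := massConst_pos n hα
    have := ballVol_pos n
    positivity
  -- The mass never falls below `a`, so each doubling of the radius adds at least `c * a ^ lam`.
  have key : ∀ k : ℕ, ENNReal.ofReal (k * (c * a ^ lam)) ≤ mass F (2 ^ k * R) := by
    intro k
    induction k with
    | zero => simp
    | succ k ih =>
      have h1 : R ≤ 2 ^ k * R := le_mul_of_one_le_left (by linarith) (one_le_pow₀ one_le_two)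
      have h := mass_two_mul hα hαn hlam hcrit hF (hR.trans h1)
      rw [← mul_assoc, ← pow_succ'] at h
      refine le_trans ?_ h
      have e : ((k + 1 : ℕ) : ℝ) * (c * a ^ lam) = k * (c * a ^ lam) + c * a ^ lam := by
        push_cast
        ring
      rw [e, ENNReal.ofReal_add (by positivity) (by positivity), ENNReal.ofReal_mul hc0.le,
        ← ENNReal.ofReal_rpow_of_nonneg ha.le hlam.le]
      gcongr
      exact haR.trans (mass_mono F (by linarith) h1)
  have hca : 0 < c * a ^ lam := by positivity
  obtain ⟨k, hk⟩ := exists_nat_ge (A / (c * a ^ lam))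
  refine ⟨2 ^ k * R, hR.trans (le_mul_of_one_le_left (by linarith) (one_le_pow₀ one_le_two)),
    le_trans (ENNReal.ofReal_le_ofReal ?_) (key k)⟩
  exact (div_le_iff₀ hca).1 hk

/-- Nonexistence for `lam > 1` on and above the critical curve `α = (n+2)/2 * (1 - 1/lam)`. -/
theorem eq_zero_of_one_lt {n : ℕ} {α lam : ℝ} (hα : 0 < α) (hαn : α ≤ ((n : ℝ) + 2) / 2)
    (hlam : 1 < lam) (hcrit : ((n : ℝ) + 2) * (lam - 1) ≤ 2 * α * lam)
    {F : SpaceTime n → ℝ≥0∞} (hFm : AEMeasurable F) (hFtop : ∀ w, F w ≠ ∞)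
    (hF : ∀ᵐ z, potential n α F z ^ lam ≤ F z) : F =ᵐ[volume] 0 := by
  by_contra hF0
  have hl0 : 0 < lam := by linarith
  have hl1 : 0 < lam - 1 := by linarith
  have hs := stepConst_pos n hα
  have hc := massConst_pos n hα
  set B : ℝ := ((2 : ℝ) ^ (α / (lam - 1))) ^ lam with hB
  have hB0 : 0 < B := by positivity
  -- With `A^(lam-1) = D`, the largeness condition of `eq_top_of_large` for `L = R²/2` reduces to
  -- `R` to the power `2 α lam - (n+2)(lam-1)` being at least 1.
  set D : ℝ := B / (stepConst n α * (1 / 2) ^ α * massConst n α ^ (lam - 1)) with hD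
  have hD0 : 0 < D := by positivity
  obtain ⟨R, hR, hA⟩ := exists_mass_ge hα hαn hl0 hcrit hFm hF0 hF (D ^ (1 / (lam - 1)))
  set A : ℝ := D ^ (1 / (lam - 1)) with hAdef
  have hA0 : 0 < A := by positivity
  have hAD : A ^ (lam - 1) = D := by
    rw [hAdef, ← Real.rpow_mul hD0.le, one_div_mul_cancel hl1.ne', Real.rpow_one]
  have hR0 : 0 < R := by linarith
  have hR2 : 0 < R ^ 2 := by positivity
  set m : ℝ := massConst n α * R ^ (2 * α - n - 2) * A with hm
  have hm0 : 0 < m := by positivity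
  have hlarge : B ≤ stepConst n α * (R ^ 2 / 2) ^ α * m ^ (lam - 1) := by
    have e : stepConst n α * (R ^ 2 / 2) ^ α * m ^ (lam - 1) =
        B * R ^ (2 * α + (2 * α - n - 2) * (lam - 1)) := by
      rw [hm, Real.mul_rpow (by positivity) hA0.le, Real.mul_rpow hc.le (by positivity), hAD, hD,
        Real.rpow_add hR0, Real.rpow_mul hR0.le (2 * α - n - 2), div_eq_mul_one_div (R ^ 2),
        Real.mul_rpow hR2.le (by norm_num), Real.rpow_mul hR0.le 2, Real.rpow_two]
      field_simp
    rw [e]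
    exact le_mul_of_one_le_right hB0.le (Real.one_le_rpow hR (by nlinarith))
  have htop := eq_top_of_large hα hαn hlam hF hR0 hm0 (L := R ^ 2 / 2) (a := 2 * R ^ 2)
    (by positivity) (by linarith) hlarge (by
      filter_upwards [le_of_mass hα hαn hl0 hF hR0] with w hw hwS
      refine le_trans ?_ (hw ⟨hwS.1, hwS.2.1, by linarith [hwS.2.2]⟩)
      rw [← ENNReal.ofReal_rpow_of_nonneg hm0.le hl0.le, hm, ENNReal.ofReal_mul (by positivity)]
      gcongr)
  have hnull : (volume : Measure (SpaceTime n)) (Metric.ball 0 R ×ˢ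
      Ioo (2 * R ^ 2 + R ^ 2 / 2) (2 * R ^ 2 + 2 * (R ^ 2 / 2))) = 0 :=
    measure_eq_zero_iff_ae_notMem.2 (htop.mono fun w hw h => hFtop w (hw h))
  rw [volume_cylinder n 0 hR0, ENNReal.ofReal_eq_zero] at hnull
  have hv := ballVol_pos n
  have : 0 < R ^ n * ballVol n * (2 * R ^ 2 + 2 * (R ^ 2 / 2) - (2 * R ^ 2 + R ^ 2 / 2)) :=
    mul_pos (by positivity) (by linarith)
  linarith

/-! ### Spreading in space for `lam < 1` -/

/-- For `lam < 1` a lower bound that is flat in space propagates to a larger ball without loss,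
provided that its profile in time vanishes fast enough at the initial time. -/
lemma strip_step {n : ℕ} {α lam : ℝ} (hα : 0 < α) (hαn : α ≤ ((n : ℝ) + 2) / 2)
    (hlam : 0 < lam) {F : SpaceTime n → ℝ≥0∞} (hF : ∀ᵐ z, potential n α F z ^ lam ≤ F z)
    {R a b K ε θ η c : ℝ} (hR : 1 ≤ R) (hθ : 0 < θ) (hθη : θ < η) (hη : η < 1) (hK0 : 0 ≤ K)
    (hK : lam * (1 + 1 / (1 - η) + K / θ) = K)
    (hc : c = kernelConst n α * (b - a) ^ (α - 1 - (n : ℝ) / 2) *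
      ((1 / 2) ^ n * ballVol n * (η - θ)))
    (hε : 0 < ε) (hεc : ε ≤ (c * ε) ^ lam)
    (hFε : ∀ᵐ w : SpaceTime n, w ∈ Metric.ball (0 : EuclideanSpace ℝ (Fin n)) R ×ˢ Ioo a b →
      ENNReal.ofReal (ε * Real.exp (-(K / (w.2 - a)))) ≤ F w) :
    ∀ᵐ w : SpaceTime n, w ∈ Metric.ball (0 : EuclideanSpace ℝ (Fin n)) (R + 1) ×ˢ Ioo a b →
      ENNReal.ofReal (ε * Real.exp (-(K / (w.2 - a)))) ≤ F w := by
  have hk := kernelConst_pos n hα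
  have hv := ballVol_pos n
  have hη' : 0 < 1 - η := by linarith
  have hηθ : 0 < η - θ := by linarith
  filter_upwards [hF] with w hw hwS
  obtain ⟨hx, ht1, ht2⟩ := hwS
  refine le_trans ?_ hw
  set l : ℝ := w.2 - a with hl
  have hl0 : 0 < l := by linarith
  have hc0 : 0 < c := by
    have : 0 < b - a := by linarith
    rw [hc]
    positivity
  have hηl : 0 < (1 - η) * l := by positivity
  have hθηl : 0 < (η - θ) * l := by positivity
  -- The past window is `(a + θl, a + ηl)`. With `d = 1` and `r = 1/2` the squared distance is at
  -- most 4, whence the cost `exp(-1/((1-η)l))`.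
  have h := le_potential_of_cylinder (F := F) hα hαn (R := R) (d := 1) (r := 1 / 2)
    (t₁ := a + θ * l) (t₂ := a + η * l) (t := w.2) (m := ε * Real.exp (-(K / (θ * l))))
    (K := 1 / ((1 - η) * l)) (by norm_num) (by linarith)
    (by norm_num) (by positivity) (by linarith) (by linarith) (by
      have e : w.2 - (a + η * l) = (1 - η) * l := by rw [hl]; ring
      rw [e, mul_assoc, one_div_mul_cancel hηl.ne']
      norm_num) (by
      have hθl : 0 < θ * l := by positivity
      filter_upwards [hFε] with v hv hvS
      obtain ⟨hv0, hv1, hv2⟩ := hvS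
      refine le_trans (ENNReal.ofReal_le_ofReal ?_) (hv ⟨hv0, by linarith, by linarith⟩)
      have : θ * l ≤ v.2 - a := by linarith
      gcongr) (x := w.1) hx
  have hbase : 0 < w.2 - (a + θ * l) := by
    have : 0 < (1 - θ) * l := mul_pos (by linarith) hl0
    linarith
  have hlow : c * ε * Real.exp (-((1 + 1 / (1 - η) + K / θ) / l)) ≤
      (kernelConst n α * (w.2 - (a + θ * l)) ^ (α - 1 - (n : ℝ) / 2) *
        Real.exp (-(1 / ((1 - η) * l)))) *
      (ε * Real.exp (-(K / (θ * l))) *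
        ((1 / 2) ^ n * ballVol n * (a + η * l - (a + θ * l)))) := by
    have e1 : -((1 + 1 / (1 - η) + K / θ) / l) =
        -(1 / ((1 - η) * l)) + -(K / (θ * l)) + -(1 / l) := by
      field_simp
      ring
    -- The length of the window contributes a factor `l`, absorbed into the exponential profile. The
    -- three exponents add up to the bracket in `hK`, whose product with `lam` is again `K`.
    have e2 : Real.exp (-(1 / l)) ≤ l := by
      rw [Real.exp_neg, inv_le_comm₀ (Real.exp_pos _) hl0, ← one_div]
      linarith [Real.add_one_le_exp (1 / l)]
    have e3 : (b - a) ^ (α - 1 - (n : ℝ) / 2) ≤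
        (w.2 - (a + θ * l)) ^ (α - 1 - (n : ℝ) / 2) := by
      have hθl : θ * l < l := by nlinarith
      have hθl' : 0 < θ * l := by positivity
      exact Real.rpow_le_rpow_of_nonpos (by linarith) (by linarith) (by linarith)
    rw [e1, Real.exp_add, Real.exp_add, hc]
    calc _ = (kernelConst n α * (b - a) ^ (α - 1 - (n : ℝ) / 2) *
          Real.exp (-(1 / ((1 - η) * l)))) * (ε * Real.exp (-(K / (θ * l))) *
          ((1 / 2) ^ n * ballVol n * ((η - θ) * Real.exp (-(1 / l))))) := by ring
      _ ≤ (kernelConst n α * (w.2 - (a + θ * l)) ^ (α - 1 - (n : ℝ) / 2) *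
          Real.exp (-(1 / ((1 - η) * l)))) * (ε * Real.exp (-(K / (θ * l))) *
          ((1 / 2) ^ n * ballVol n * ((η - θ) * l))) := by gcongr
      _ = _ := by ring
  have hpow : ε * Real.exp (-(K / l)) ≤
      (c * ε * Real.exp (-((1 + 1 / (1 - η) + K / θ) / l))) ^ lam := by
    rw [Real.mul_rpow (by positivity) (Real.exp_pos _).le, ← Real.exp_mul]
    have e : -((1 + 1 / (1 - η) + K / θ) / l) * lam = -(K / l) := by
      conv_rhs => rw [← hK]
      ring
    rw [e]
    gcongr
  refine (ENNReal.ofReal_le_ofReal hpow).trans ?_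
  rw [← ENNReal.ofReal_rpow_of_nonneg (by positivity) hlam.le]
  exact ENNReal.rpow_le_rpow ((ENNReal.ofReal_le_ofReal hlow).trans h) hlam.le

/-- For `lam < 1`, a nonzero function `F ≥ (J_α F)^lam` is bounded below on a whole strip. -/
theorem exists_strip_of_lt_one {n : ℕ} {α lam : ℝ} (hα : 0 < α) (hαn : α ≤ ((n : ℝ) + 2) / 2)
    (hlam : 0 < lam) (hlam1 : lam < 1) {F : SpaceTime n → ℝ≥0∞} (hFm : AEMeasurable F)
    (hF0 : ¬ (F =ᵐ[volume] 0)) (hF : ∀ᵐ z, potential n α F z ^ lam ≤ F z) :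
    ∃ a b m : ℝ, a < b ∧ 0 < m ∧
      ∀ᵐ w : SpaceTime n, w.2 ∈ Ioo a b → ENNReal.ofReal m ≤ F w := by
  obtain ⟨R, hR, hpos⟩ := exists_mass_pos hFm hF0
  have hR0 : 0 < R := by linarith
  have hmc := massConst_pos n hα
  have hk := kernelConst_pos n hα
  have hv := ballVol_pos n
  obtain ⟨A, hA, hAR⟩ : ∃ A : ℝ, 0 < A ∧ ENNReal.ofReal A ≤
      (ENNReal.ofReal (massConst n α * R ^ (2 * α - n - 2)) * mass F R) ^ lam := by
    set M := (ENNReal.ofReal (massConst n α * R ^ (2 * α - n - 2)) * mass F R) ^ lam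
    have hM : M ≠ 0 := by
      refine (ENNReal.rpow_pos_of_nonneg (ENNReal.mul_pos ?_ hpos.ne') hlam.le).ne'
      exact (ENNReal.ofReal_pos.2 (by positivity)).ne'
    rcases eq_or_ne M ∞ with h | h
    · exact ⟨1, one_pos, h ▸ le_top⟩
    · exact ⟨M.toReal, ENNReal.toReal_pos hM h, (ENNReal.ofReal_toReal h).le⟩
  set a : ℝ := 2 * R ^ 2 with ha
  set b : ℝ := 3 * R ^ 2 with hb
  have hR2 : 0 < R ^ 2 := by positivity
  have hab : 0 < b - a := by linarith
  -- Since `lam < θ < 1`, the equation for `K` has slope `lam/θ < 1` and therefore a nonnegative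
  -- solution.
  set θ : ℝ := (1 + lam) / 2 with hθ
  set η : ℝ := (1 + θ) / 2 with hη
  have hθ0 : 0 < θ := by linarith
  have hθ1 : θ < 1 := by linarith
  have hlθ : lam < θ := by linarith
  have hη1 : 0 < 1 - η := by linarith
  have hηθ : 0 < η - θ := by linarith
  have hθl : 0 < θ - lam := by linarith
  set K : ℝ := lam * (1 + 1 / (1 - η)) * θ / (θ - lam) with hK
  have hK0 : 0 ≤ K := by positivity
  have hKeq : lam * (1 + 1 / (1 - η) + K / θ) = K := by
    rw [hK]
    field_simp
    ring
  set c : ℝ := kernelConst n α * (b - a) ^ (α - 1 - (n : ℝ) / 2) *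
      ((1 / 2) ^ n * ballVol n * (η - θ)) with hc
  have hc0 : 0 < c := by positivity
  have h1l : 0 < 1 - lam := by linarith
  -- The bound by `A` starts the induction; the other one is equivalent to `ε ≤ (c ε)^lam` because
  -- `lam < 1`.
  set ε : ℝ := min A (c ^ (lam / (1 - lam))) with hε
  have hε0 : 0 < ε := lt_min hA (by positivity)
  have hεc : ε ≤ (c * ε) ^ lam := by
    have h1 : ε ^ (1 - lam) ≤ c ^ lam := by
      calc ε ^ (1 - lam) ≤ (c ^ (lam / (1 - lam))) ^ (1 - lam) :=
            Real.rpow_le_rpow hε0.le (min_le_right _ _) h1l.le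
        _ = c ^ lam := by
            rw [← Real.rpow_mul hc0.le]
            congr 1
            field_simp
    calc ε = ε ^ (1 - lam) * ε ^ lam := by
          rw [← Real.rpow_add hε0, sub_add_cancel, Real.rpow_one]
      _ ≤ c ^ lam * ε ^ lam := by gcongr
      _ = (c * ε) ^ lam := (Real.mul_rpow hc0.le hε0.le).symm
  have key : ∀ k : ℕ, ∀ᵐ w : SpaceTime n,
      w ∈ Metric.ball (0 : EuclideanSpace ℝ (Fin n)) (R + k) ×ˢ Ioo a b →
      ENNReal.ofReal (ε * Real.exp (-(K / (w.2 - a)))) ≤ F w := by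
    intro k
    induction k with
    | zero =>
      filter_upwards [le_of_mass hα hαn hlam hF hR0] with w hw hwS
      refine le_trans (le_trans (ENNReal.ofReal_le_ofReal ?_) hAR) (hw (by simpa using hwS))
      have h1 : 0 ≤ K / (w.2 - a) := div_nonneg hK0 (by linarith [hwS.2.1])
      calc ε * Real.exp (-(K / (w.2 - a))) ≤ ε * 1 := by
            gcongr
            exact Real.exp_le_one_iff.2 (by linarith)
        _ ≤ A := by rw [mul_one]; exact min_le_left _ _
    | succ k ih =>
      have h := strip_step hα hαn hlam hF (hR.trans (le_add_of_nonneg_right k.cast_nonneg)) hθ0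
        (by linarith) (by linarith) hK0 hKeq hc hε0 hεc ih
      simpa only [Nat.cast_add, Nat.cast_one, add_assoc] using h
  -- The profile may degenerate at time `a`, so only the later half of the interval is kept.
  refine ⟨(a + b) / 2, b, ε * Real.exp (-(K / ((b - a) / 2))), by linarith, by positivity, ?_⟩
  filter_upwards [ae_all_iff.2 key] with w hw hwt
  obtain ⟨k, hk⟩ := exists_nat_ge ‖w.1‖
  refine le_trans (ENNReal.ofReal_le_ofReal ?_) (hw k ⟨?_, by linarith [hwt.1], hwt.2⟩)
  · have : (b - a) / 2 ≤ w.2 - a := by linarith [hwt.1]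
    gcongr
  · simp only [Metric.mem_ball, dist_zero_right]
    linarith

/-! ### From the problem to the integral inequality, and necessity -/

lemma measurableSet_past (n : ℕ) (T : ℝ) : MeasurableSet (past n T) :=
  measurableSet_lt measurable_snd measurable_const

lemma aemeasurable_of_mem_X {n : ℕ} {p : ℝ} {f : SpaceTime n → ℝ} (hf : f ∈ X n p) :
    AEMeasurable f := by
  have hcov : (⋃ k : ℕ, past n k) = univ := by
    refine eq_univ_of_forall fun w => mem_iUnion.2 ?_
    obtain ⟨k, hk⟩ := exists_nat_gt w.2
    exact ⟨k, hk⟩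
  rw [← Measure.restrict_univ (μ := (volume : Measure (SpaceTime n))), ← hcov]
  exact aemeasurable_iUnion_iff.2 fun k => (hf k).1.aemeasurable

lemma Phi_of_nonpos (n : ℕ) (α : ℝ) (x : EuclideanSpace ℝ (Fin n)) {t : ℝ} (ht : t ≤ 0) :
    Phi n α x t = 0 := by
  rw [Phi, if_neg ht.not_gt]

lemma potential_eq_setLIntegral {n : ℕ} {α : ℝ} (hα : 0 < α) (f : SpaceTime n → ℝ)
    (z : SpaceTime n) :
    potential n α (fun w => ENNReal.ofReal (f w)) z =
      ∫⁻ w in past n z.2, ENNReal.ofReal (jIntegrand n α f z w) := by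
  rw [potential, ← lintegral_indicator (measurableSet_past n z.2)]
  refine lintegral_congr fun w => ?_
  by_cases hw : w ∈ past n z.2
  · rw [indicator_of_mem hw, jIntegrand, ENNReal.ofReal_mul (Phi_nonneg n hα _ _)]
  · rw [indicator_of_notMem hw, Phi_of_nonpos n α _ (sub_nonpos.2 (not_lt.1 hw))]
    simp

/-- For nonnegative `f` absolute convergence identifies the Bochner integral with the lower
integral; this carries solutions over to `potential`. -/
lemma IsJ.potential_eq {n : ℕ} {α : ℝ} (hα : 0 < α) {f u : SpaceTime n → ℝ}
    (hf : ∀ᵐ w, 0 ≤ f w) (h : IsJ n α f u) :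
    ∀ᵐ z, potential n α (fun w => ENNReal.ofReal (f w)) z = ENNReal.ofReal (u z) := by
  filter_upwards [h] with z hz
  rw [potential_eq_setLIntegral hα, hz.2, J, ofReal_integral_eq_lintegral_ofReal hz.1]
  filter_upwards [ae_restrict_of_ae hf] with w hw
  exact mul_nonneg (Phi_nonneg n hα _ _) hw

/-- The necessary condition on `(lam, α)` for the existence of a nontrivial solution. -/
theorem necessary {n : ℕ} (hn : 1 ≤ n) {p α lam : ℝ} (hp : 1 ≤ p) (hα : 0 < α)
    (hαn : α ≤ ((n : ℝ) + 2) / 2) (hlam : 0 < lam) {u : SpaceTime n → ℝ}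
    (hu : IsNonnegSuperSolution n p α lam u) (hu0 : ¬ ∀ᵐ z, u z = 0) :
    lam = 1 ∨ (1 < lam ∧ 2 * α * lam < ((n : ℝ) + 2) * (lam - 1)) := by
  obtain ⟨f, ⟨hfX, hfu⟩, huf⟩ := hu.super
  have hf0 : ∀ᵐ w, 0 ≤ f w := by
    filter_upwards [hu.nonneg, huf] with w h1 h2
    exact (Real.rpow_nonneg h1 lam).trans h2
  set F : SpaceTime n → ℝ≥0∞ := fun w => ENNReal.ofReal (f w) with hFdef
  have hFm : AEMeasurable F := (aemeasurable_of_mem_X hfX).ennreal_ofReal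
  have hpot := hfu.potential_eq hα hf0
  have hF : ∀ᵐ z, potential n α F z ^ lam ≤ F z := by
    filter_upwards [hpot, hu.nonneg, huf] with z h1 h2 h3
    rw [h1, ENNReal.ofReal_rpow_of_nonneg h2 hlam.le]
    exact ENNReal.ofReal_le_ofReal h3
  have hF0 : ¬ (F =ᵐ[volume] 0) := by
    intro h
    refine hu0 ?_
    filter_upwards [hpot, hu.nonneg] with z h1 h2
    have : potential n α F z = 0 := by
      rw [potential, ← lintegral_zero (μ := (volume : Measure (SpaceTime n)))]
      refine lintegral_congr_ae ?_
      filter_upwards [h] with w hw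
      simp [hw]
    rw [this] at h1
    exact le_antisymm (ENNReal.ofReal_eq_zero.1 h1.symm) h2
  rcases lt_trichotomy lam 1 with h1 | h1 | h1
  · exfalso
    obtain ⟨a, b, m, hab, hm, hFab⟩ := exists_strip_of_lt_one hα hαn hlam h1 hFm hF0 hF
    -- Chebyshev's inequality: `f` exceeds `m` only on a set of finite measure, whereas the strip
    -- has infinite measure because `n ≥ 1`.
    have hfin := (hfX b).meas_ge_lt_top'_enorm
      (ENNReal.ofReal_pos.2 (by linarith)).ne' ENNReal.ofReal_ne_top
      (ENNReal.ofReal_pos.2 hm).ne' (by simp)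
    have hS : MeasurableSet (univ ×ˢ Ioo a b : Set (SpaceTime n)) :=
      MeasurableSet.univ.prod measurableSet_Ioo
    have hle : (volume : Measure (SpaceTime n)) (univ ×ˢ Ioo a b) ≤
        (volume.restrict (past n b)) {w | ENNReal.ofReal m ≤ ‖f w‖ₑ} := by
      have hsub : (univ ×ˢ Ioo a b : Set (SpaceTime n)) ⊆ past n b := fun w hw => hw.2.2
      rw [← Measure.restrict_eq_self volume hsub]
      refine measure_mono_ae (ae_restrict_of_ae ?_)
      filter_upwards [hFab] with w hw hwS
      refine (hw hwS.2).trans ?_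
      exact Real.ofReal_le_enorm (f w)
    have : Nonempty (Fin n) := ⟨⟨0, hn⟩⟩
    rw [Measure.volume_eq_prod, Measure.prod_prod, Real.volume_Ioo,
      measure_univ_of_isAddLeftInvariant, ENNReal.top_mul (by simpa using hab)] at hle
    exact absurd hfin (by simpa [Measure.volume_eq_prod] using hle)
  · exact Or.inl h1
  · refine Or.inr ⟨h1, ?_⟩
    by_contra! hcrit
    exact hF0 (eq_zero_of_one_lt hα hαn h1 hcrit hFm (fun w => ENNReal.ofReal_ne_top) hF)

/-! ### The heat kernel and its semigroup property -/

/-- The heat kernel on `ℝⁿ`. -/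
noncomputable def heatKernel (n : ℕ) (x : EuclideanSpace ℝ (Fin n)) (t : ℝ) : ℝ :=
  1 / (4 * π * t) ^ ((n : ℝ) / 2) * Real.exp (-‖x‖ ^ 2 / (4 * t))

lemma heatKernel_pos (n : ℕ) (x : EuclideanSpace ℝ (Fin n)) {t : ℝ} (ht : 0 < t) :
    0 < heatKernel n x t := by
  unfold heatKernel
  positivity

lemma heatKernel_le (n : ℕ) (x : EuclideanSpace ℝ (Fin n)) {t : ℝ} (ht : 0 < t) :
    heatKernel n x t ≤ t ^ (-((n : ℝ) / 2)) := by
  have h1 : Real.exp (-‖x‖ ^ 2 / (4 * t)) ≤ 1 := by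
    rw [neg_div]
    exact Real.exp_le_one_iff.2 (neg_nonpos.2 (by positivity))
  have h2 : t ≤ 4 * π * t := le_mul_of_one_le_left ht.le (by linarith [Real.pi_gt_three])
  calc heatKernel n x t ≤ 1 / (4 * π * t) ^ ((n : ℝ) / 2) * 1 := by
        unfold heatKernel
        gcongr
    _ ≤ 1 / t ^ ((n : ℝ) / 2) := by
        rw [mul_one]
        gcongr
    _ = t ^ (-((n : ℝ) / 2)) := by rw [Real.rpow_neg ht.le, one_div]

lemma Phi_eq_heatKernel (n : ℕ) (α : ℝ) (x : EuclideanSpace ℝ (Fin n)) {t : ℝ} (ht : 0 < t) :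
    Phi n α x t = t ^ (α - 1) / Real.Gamma α * heatKernel n x t := by
  rw [Phi, if_pos ht, heatKernel, mul_assoc]

lemma measurable_heatKernel (n : ℕ) : Measurable fun w : SpaceTime n => heatKernel n w.1 w.2 := by
  unfold heatKernel
  fun_prop

lemma measurable_Phi (n : ℕ) (α : ℝ) : Measurable fun w : SpaceTime n => Phi n α w.1 w.2 := by
  unfold Phi
  exact Measurable.ite (measurableSet_lt measurable_const measurable_snd) (by fun_prop)
    measurable_const

lemma lintegral_gaussian (n : ℕ) {b : ℝ} (hb : 0 < b) :
    ∫⁻ ξ : EuclideanSpace ℝ (Fin n), ENNReal.ofReal (Real.exp (-b * ‖ξ‖ ^ 2)) =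
      ENNReal.ofReal ((π / b) ^ ((n : ℝ) / 2)) := by
  have h := GaussianFourier.integral_rexp_neg_mul_sq_norm (V := EuclideanSpace ℝ (Fin n)) hb
  rw [finrank_euclideanSpace, Fintype.card_fin] at h
  have hint : Integrable fun ξ : EuclideanSpace ℝ (Fin n) => Real.exp (-b * ‖ξ‖ ^ 2) := by
    -- The integral of a nonintegrable function is 0 by convention, but the value in `h` is
    -- positive.
    by_contra hc
    rw [integral_undef hc] at h
    have : 0 < (π / b) ^ ((n : ℝ) / 2) := by positivity
    linarith
  rw [← h, ofReal_integral_eq_lintegral_ofReal hint (.of_forall fun _ => (Real.exp_pos _).le)]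

lemma lintegral_heatKernel (n : ℕ) {t : ℝ} (ht : 0 < t) :
    ∫⁻ ξ, ENNReal.ofReal (heatKernel n ξ t) = 1 := by
  have e : ∀ ξ : EuclideanSpace ℝ (Fin n), ENNReal.ofReal (heatKernel n ξ t) =
      ENNReal.ofReal (1 / (4 * π * t) ^ ((n : ℝ) / 2)) *
        ENNReal.ofReal (Real.exp (-(1 / (4 * t)) * ‖ξ‖ ^ 2)) := by
    intro ξ
    rw [heatKernel, ENNReal.ofReal_mul (by positivity)]
    congr 3
    ring
  simp_rw [e]
  rw [lintegral_const_mul' _ _ ENNReal.ofReal_ne_top, lintegral_gaussian n (by positivity),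
    ← ENNReal.ofReal_mul (by positivity), ← ENNReal.ofReal_one]
  congr 1
  rw [show π / (1 / (4 * t)) = 4 * π * t by field_simp]
  exact one_div_mul_cancel (by positivity)

/-- The semigroup property of the heat kernel. -/
lemma lintegral_heatKernel_mul (n : ℕ) (x : EuclideanSpace ℝ (Fin n)) {s r : ℝ} (hs : 0 < s)
    (hr : 0 < r) :
    ∫⁻ ξ, ENNReal.ofReal (heatKernel n (x - ξ) s * heatKernel n ξ r) =
      ENNReal.ofReal (heatKernel n x (s + r)) := by
  -- Completing the square in `ξ` gives a Gaussian of rate `b` centred at `y`.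
  set b : ℝ := (s + r) / (4 * s * r) with hb
  have hb0 : 0 < b := by positivity
  set y : EuclideanSpace ℝ (Fin n) := (r / (s + r)) • x with hy
  have e : ∀ ξ, ENNReal.ofReal (heatKernel n (x - ξ) s * heatKernel n ξ r) =
      ENNReal.ofReal (heatKernel n x (s + r) / (π / b) ^ ((n : ℝ) / 2)) *
        ENNReal.ofReal (Real.exp (-b * ‖ξ - y‖ ^ 2)) := by
    intro ξ
    have h0 := heatKernel_pos n x (add_pos hs hr)
    rw [← ENNReal.ofReal_mul (by positivity)]
    congr 1
    have hexp : Real.exp (-‖x - ξ‖ ^ 2 / (4 * s)) * Real.exp (-‖ξ‖ ^ 2 / (4 * r)) =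
        Real.exp (-‖x‖ ^ 2 / (4 * (s + r))) * Real.exp (-b * ‖ξ - y‖ ^ 2) := by
      rw [← Real.exp_add, ← Real.exp_add]
      congr 1
      rw [norm_sub_sq_real, norm_sub_sq_real, hy, norm_smul, inner_smul_right,
        real_inner_comm ξ x, hb, Real.norm_eq_abs, abs_of_nonneg (by positivity)]
      field_simp
      ring
    have hconst : (4 * π * s) ^ ((n : ℝ) / 2) * (4 * π * r) ^ ((n : ℝ) / 2) =
        (4 * π * (s + r)) ^ ((n : ℝ) / 2) * (π / b) ^ ((n : ℝ) / 2) := by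
      rw [← Real.mul_rpow (by positivity) (by positivity),
        ← Real.mul_rpow (by positivity) (by positivity), hb]
      congr 1
      field_simp
    unfold heatKernel
    calc _ = 1 / ((4 * π * s) ^ ((n : ℝ) / 2) * (4 * π * r) ^ ((n : ℝ) / 2)) *
          (Real.exp (-‖x - ξ‖ ^ 2 / (4 * s)) * Real.exp (-‖ξ‖ ^ 2 / (4 * r))) := by
          field_simp
      _ = _ := by
          rw [hexp, hconst]
          field_simp
  simp_rw [e]
  have h0 := heatKernel_pos n x (add_pos hs hr)
  rw [lintegral_const_mul' _ _ ENNReal.ofReal_ne_top,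
    lintegral_sub_right_eq_self (fun ξ => ENNReal.ofReal (Real.exp (-b * ‖ξ‖ ^ 2))) y,
    lintegral_gaussian n hb0, ← ENNReal.ofReal_mul (by positivity)]
  congr 1
  field_simp

/-! ### Solutions with a heat kernel profile -/

/-- The function `h(t) G(x, t+1)` for `t > 0`, extended by zero, where `G` is the heat kernel. -/
noncomputable def profile (n : ℕ) (h : ℝ → ℝ) (w : SpaceTime n) : ℝ :=
  if 0 < w.2 then h w.2 * heatKernel n w.1 (w.2 + 1) else 0

lemma measurable_profile (n : ℕ) {h : ℝ → ℝ} (hm : Measurable h) : Measurable (profile n h) := by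
  have hk := (measurable_heatKernel n).comp
    (measurable_fst.prodMk (measurable_snd.add_const 1) : Measurable fun w : SpaceTime n =>
      ((w.1, w.2 + 1) : SpaceTime n))
  exact Measurable.ite (measurableSet_lt measurable_const measurable_snd)
    ((hm.comp measurable_snd).mul hk) measurable_const

lemma profile_nonneg (n : ℕ) {h : ℝ → ℝ} (hpos : ∀ t, 0 < t → 0 < h t) (w : SpaceTime n) :
    0 ≤ profile n h w := by
  unfold profile
  split_ifs with hw
  · have := hpos _ hw
    have := heatKernel_pos n w.1 (show 0 < w.2 + 1 by linarith)
    positivity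
  · exact le_rfl

/-- On the functions `profile n h` the potential acts as a fractional integral in time. -/
lemma potential_profile (n : ℕ) {α : ℝ} (hα : 0 < α) {h : ℝ → ℝ} (hm : Measurable h)
    (hpos : ∀ t, 0 < t → 0 < h t) (z : SpaceTime n) :
    potential n α (fun w => ENNReal.ofReal (profile n h w)) z =
      ENNReal.ofReal (heatKernel n z.1 (z.2 + 1)) *
        ∫⁻ τ in Ioo 0 z.2, ENNReal.ofReal ((z.2 - τ) ^ (α - 1) / Real.Gamma α * h τ) := by
  have hΓ := Real.Gamma_pos_of_pos hα
  have hmeas : Measurable fun w : SpaceTime n =>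
      ENNReal.ofReal (Phi n α (z.1 - w.1) (z.2 - w.2)) * ENNReal.ofReal (profile n h w) :=
    ((measurable_Phi n α).comp (measurable_const.sub measurable_id :
      Measurable fun w : SpaceTime n => z - w)).ennreal_ofReal.mul
      (measurable_profile n hm).ennreal_ofReal
  rw [potential, Measure.volume_eq_prod, lintegral_prod_symm _ hmeas.aemeasurable,
    ← lintegral_const_mul' _ _ ENNReal.ofReal_ne_top, ← lintegral_indicator measurableSet_Ioo]
  refine lintegral_congr fun τ => ?_
  by_cases hτ : τ ∈ Ioo 0 z.2
  · obtain ⟨h0, h1⟩ := hτ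
    have hs : 0 < z.2 - τ := by linarith
    have hh := hpos τ h0
    rw [indicator_of_mem (show τ ∈ Ioo 0 z.2 from ⟨h0, h1⟩), mul_comm]
    have e : ∀ ξ : EuclideanSpace ℝ (Fin n), ENNReal.ofReal (Phi n α (z.1 - ξ) (z.2 - τ)) *
        ENNReal.ofReal (profile n h (ξ, τ)) =
        ENNReal.ofReal ((z.2 - τ) ^ (α - 1) / Real.Gamma α * h τ) *
        ENNReal.ofReal (heatKernel n (z.1 - ξ) (z.2 - τ) * heatKernel n ξ (τ + 1)) := by
      intro ξ
      rw [← ENNReal.ofReal_mul (Phi_nonneg n hα _ _), ← ENNReal.ofReal_mul (by positivity),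
        Phi_eq_heatKernel n α _ hs, profile, if_pos h0]
      congr 1
      ring
    simp_rw [e]
    rw [lintegral_const_mul' _ _ ENNReal.ofReal_ne_top,
      lintegral_heatKernel_mul n z.1 hs (by linarith),
      show z.2 - τ + (τ + 1) = z.2 + 1 by ring]
  · rw [indicator_of_notMem hτ]
    refine (lintegral_congr fun ξ => ?_).trans lintegral_zero
    rcases le_or_gt τ 0 with h0 | h0
    · simp [profile, h0.not_gt]
    · have h1 : z.2 ≤ τ := by
        by_contra! h1
        exact hτ ⟨h0, h1⟩
      simp [Phi_of_nonpos n α _ (sub_nonpos.2 h1)]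

/-- The time shift by 1 keeps `G ≤ 1`, so `G^p ≤ G`, whose integral over space is 1. -/
lemma profile_mem_X (n : ℕ) {p : ℝ} (hp : 1 ≤ p) {h : ℝ → ℝ} (hm : Measurable h)
    (hpos : ∀ t, 0 < t → 0 < h t) (hbdd : ∀ T, ∃ C, ∀ t, 0 < t → t < T → h t ≤ C) :
    profile n h ∈ X n p := by
  intro T
  have hp0 : 0 < p := by linarith
  refine ⟨(measurable_profile n hm).aestronglyMeasurable, ?_⟩
  rw [eLpNorm_lt_top_iff_lintegral_rpow_enorm_lt_top (ENNReal.ofReal_pos.2 hp0).ne'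
    ENNReal.ofReal_ne_top, ENNReal.toReal_ofReal hp0.le]
  obtain ⟨C, hC⟩ := hbdd T
  have hmeas : Measurable fun w : SpaceTime n => (Ioo 0 T).indicator
      (fun _ => ENNReal.ofReal (C ^ p)) w.2 * ENNReal.ofReal (heatKernel n w.1 (w.2 + 1)) := by
    refine Measurable.mul ((measurable_const.indicator measurableSet_Ioo).comp measurable_snd) ?_
    exact ((measurable_heatKernel n).comp
      (measurable_fst.prodMk (measurable_snd.add_const 1) : Measurable fun w : SpaceTime n =>
      ((w.1, w.2 + 1) : SpaceTime n))).ennreal_ofReal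
  calc ∫⁻ w in past n T, ‖profile n h w‖ₑ ^ p
      ≤ ∫⁻ w in past n T, (Ioo 0 T).indicator (fun _ => ENNReal.ofReal (C ^ p)) w.2 *
          ENNReal.ofReal (heatKernel n w.1 (w.2 + 1)) := by
        refine lintegral_mono_ae ((ae_restrict_iff' (measurableSet_past n T)).2
          (.of_forall fun (w : SpaceTime n) (hw : w.2 < T) => ?_))
        rw [Real.enorm_of_nonneg (profile_nonneg n hpos w),
          ENNReal.ofReal_rpow_of_nonneg (profile_nonneg n hpos w) hp0.le, profile]
        split_ifs with h0
        · have hk := heatKernel_pos n w.1 (show 0 < w.2 + 1 by linarith)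
          have hk1 : heatKernel n w.1 (w.2 + 1) ≤ 1 :=
            (heatKernel_le n w.1 (by linarith)).trans
              (Real.rpow_le_one_of_one_le_of_nonpos (by linarith) (neg_nonpos.2 (by positivity)))
          have hh := hpos _ h0
          have hhC := hC _ h0 hw
          rw [indicator_of_mem (show w.2 ∈ Ioo 0 T from ⟨h0, hw⟩),
            ← ENNReal.ofReal_mul (Real.rpow_nonneg (hh.le.trans hhC) _),
            Real.mul_rpow hh.le hk.le]
          have hkp : heatKernel n w.1 (w.2 + 1) ^ p ≤ heatKernel n w.1 (w.2 + 1) := by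
            simpa using Real.rpow_le_rpow_of_exponent_ge hk hk1 hp
          exact ENNReal.ofReal_le_ofReal (mul_le_mul (Real.rpow_le_rpow hh.le hhC hp0.le) hkp
            (by positivity) (Real.rpow_nonneg (hh.le.trans hhC) _))
        · simp [Real.zero_rpow hp0.ne']
    _ ≤ ∫⁻ w : SpaceTime n, (Ioo 0 T).indicator (fun _ => ENNReal.ofReal (C ^ p)) w.2 *
          ENNReal.ofReal (heatKernel n w.1 (w.2 + 1)) := setLIntegral_le_lintegral _ _
    _ = ∫⁻ τ in Ioo 0 T, ENNReal.ofReal (C ^ p) := by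
        rw [Measure.volume_eq_prod, lintegral_prod_symm _ hmeas.aemeasurable,
          ← lintegral_indicator measurableSet_Ioo]
        refine lintegral_congr fun τ => ?_
        by_cases hτ : τ ∈ Ioo 0 T
        · simp only [indicator_of_mem hτ]
          rw [lintegral_const_mul' _ _ ENNReal.ofReal_ne_top,
            lintegral_heatKernel n (by linarith [hτ.1]), mul_one]
        · simp [indicator_of_notMem hτ]
    _ < ∞ := by
        rw [setLIntegral_const, Real.volume_Ioo]
        exact ENNReal.mul_lt_top ENNReal.ofReal_lt_top ENNReal.ofReal_lt_top

/-- A supersolution of the associated integral inequality in time gives a solution. -/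
theorem exists_of_profile (n : ℕ) {p α lam : ℝ} (hp : 1 ≤ p) (hα : 0 < α) (hlam : 0 < lam)
    {h H : ℝ → ℝ} (hm : Measurable h) (hpos : ∀ t, 0 < t → 0 < h t)
    (hbdd : ∀ T, ∃ C, ∀ t, 0 < t → t < T → h t ≤ C)
    (hH : ∀ t, 0 < t → 0 ≤ H t ∧
      ∫⁻ τ in Ioo 0 t, ENNReal.ofReal ((t - τ) ^ (α - 1) / Real.Gamma α * h τ) ≤
        ENNReal.ofReal (H t))
    (hsuper : ∀ t, 0 < t → ∀ x : EuclideanSpace ℝ (Fin n),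
      (heatKernel n x (t + 1) * H t) ^ lam ≤ h t * heatKernel n x (t + 1)) :
    ∃ u : SpaceTime n → ℝ, IsNonnegSuperSolution n p α lam u ∧ ¬ ∀ᵐ z, u z = 0 := by
  have hΓ := Real.Gamma_pos_of_pos hα
  set f := profile n h with hf
  have hf0 := profile_nonneg n hpos
  have hfX : f ∈ X n p := profile_mem_X n hp hm hpos hbdd
  have hjm : ∀ z, Measurable (jIntegrand n α f z) := fun z =>
    ((measurable_Phi n α).comp (measurable_const.sub measurable_id :
      Measurable fun w : SpaceTime n => z - w)).mul (measurable_profile n hm)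
  have hj0 : ∀ z w, 0 ≤ jIntegrand n α f z w := fun z w =>
    mul_nonneg (Phi_nonneg n hα _ _) (hf0 w)
  have hle : ∀ z : SpaceTime n, 0 < z.2 →
      potential n α (fun w => ENNReal.ofReal (f w)) z ≤
        ENNReal.ofReal (heatKernel n z.1 (z.2 + 1) * H z.2) := by
    intro z hz
    rw [potential_profile n hα hm hpos,
      ENNReal.ofReal_mul (heatKernel_pos n z.1 (by linarith)).le]
    gcongr
    exact (hH _ hz).2
  have hzero : ∀ z : SpaceTime n, z.2 ≤ 0 →
      potential n α (fun w => ENNReal.ofReal (f w)) z = 0 := by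
    intro z hz
    rw [potential_profile n hα hm hpos, Ioo_eq_empty hz.not_gt]
    simp
  have hfin : ∀ z, potential n α (fun w => ENNReal.ofReal (f w)) z ≠ ∞ := by
    intro z
    rcases le_or_gt z.2 0 with hz | hz
    · simp [hzero z hz]
    · exact ((hle z hz).trans_lt ENNReal.ofReal_lt_top).ne
  have hint : ∀ z, IntegrableOn (jIntegrand n α f z) (past n z.2) := by
    intro z
    refine ⟨(hjm z).aestronglyMeasurable, ?_⟩
    rw [hasFiniteIntegral_iff_ofReal (.of_forall (hj0 z)), ← potential_eq_setLIntegral hα]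
    exact (hfin z).lt_top
  have hJ : ∀ z, J n α f z = (potential n α (fun w => ENNReal.ofReal (f w)) z).toReal := by
    intro z
    rw [J, integral_eq_lintegral_of_nonneg_ae (.of_forall (hj0 z))
      (hjm z).aestronglyMeasurable, ← potential_eq_setLIntegral hα]
  have hIsJ : IsJ n α f (J n α f) := .of_forall fun z => ⟨hint z, rfl⟩
  refine ⟨J n α f, ⟨⟨f, hfX, hIsJ⟩, .of_forall fun z => ?_, ⟨f, ⟨hfX, hIsJ⟩,
    .of_forall fun z => ?_⟩, .of_forall fun z hz => ?_⟩, fun h0 => ?_⟩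
  · rw [hJ]
    exact ENNReal.toReal_nonneg
  · rcases le_or_gt z.2 0 with hz | hz
    · rw [hJ, hzero z hz, ENNReal.toReal_zero, Real.zero_rpow hlam.ne']
      exact hf0 z
    · have hk := heatKernel_pos n z.1 (show 0 < z.2 + 1 by linarith)
      have h1 : J n α f z ≤ heatKernel n z.1 (z.2 + 1) * H z.2 := by
        rw [hJ]
        exact ENNReal.toReal_le_of_le_ofReal (mul_nonneg hk.le (hH _ hz).1) (hle z hz)
      have h2 : f z = h z.2 * heatKernel n z.1 (z.2 + 1) := if_pos hz
      rw [h2]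
      refine le_trans (Real.rpow_le_rpow ?_ h1 hlam.le) (hsuper _ hz z.1)
      rw [hJ]
      exact ENNReal.toReal_nonneg
  · rw [hJ, hzero z hz.le, ENNReal.toReal_zero]
  · have hS : (volume : Measure (SpaceTime n))
        (Metric.ball (0 : EuclideanSpace ℝ (Fin n)) 1 ×ˢ Ioo (0 : ℝ) 1) ≠ 0 := by
      rw [volume_cylinder n 0 one_pos]
      have := ballVol_pos n
      exact (ENNReal.ofReal_pos.2 (by positivity)).ne'
    obtain ⟨z, hzS, hz⟩ : ∃ z, z ∈ Metric.ball (0 : EuclideanSpace ℝ (Fin n)) 1 ×ˢ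
        Ioo (0 : ℝ) 1 ∧ J n α f z = 0 := by
      by_contra! hc
      refine hS (measure_eq_zero_iff_ae_notMem.2 ?_)
      filter_upwards [h0] with z hz hzS
      exact hc z hzS hz
    have hz2 : 0 < z.2 := hzS.2.1
    have hk := heatKernel_pos n z.1 (show 0 < z.2 + 1 by linarith)
    rw [hJ, ENNReal.toReal_eq_zero_iff, or_iff_left (hfin z), potential_profile n hα hm hpos,
      mul_eq_zero, or_iff_right (ENNReal.ofReal_pos.2 hk).ne'] at hz
    have hgm : Measurable fun τ : ℝ =>
        ENNReal.ofReal ((z.2 - τ) ^ (α - 1) / Real.Gamma α * h τ) := by fun_prop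
    refine ((setLIntegral_pos_iff hgm).2 ?_).ne' hz
    have hsub : Ioo 0 z.2 ⊆ (Function.support fun τ : ℝ =>
        ENNReal.ofReal ((z.2 - τ) ^ (α - 1) / Real.Gamma α * h τ)) ∩ Ioo 0 z.2 := by
      intro τ hτ
      refine ⟨(ENNReal.ofReal_pos.2 ?_).ne', hτ⟩
      have h1 : 0 < z.2 - τ := by linarith [hτ.2]
      have h2 := hpos τ hτ.1
      positivity
    refine lt_of_lt_of_le ?_ (measure_mono hsub)
    rw [Real.volume_Ioo]
    exact ENNReal.ofReal_pos.2 (by linarith)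

/-! ### Time profiles for `lam = 1` and for `lam > 1` -/

lemma setLIntegral_Ioo_reflect (t : ℝ) (g : ℝ → ℝ≥0∞) :
    ∫⁻ τ in Ioo 0 t, g (t - τ) = ∫⁻ s in Ioo 0 t, g s := by
  rw [← lintegral_indicator measurableSet_Ioo, ← lintegral_indicator measurableSet_Ioo,
    ← lintegral_sub_left_eq_self ((Ioo 0 t).indicator g) t]
  refine lintegral_congr fun τ => ?_
  have : t - τ ∈ Ioo 0 t ↔ τ ∈ Ioo 0 t := by
    simp only [mem_Ioo]
    constructor <;> rintro ⟨h1, h2⟩ <;> constructor <;> linarith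
  by_cases hτ : τ ∈ Ioo 0 t
  · rw [indicator_of_mem hτ, indicator_of_mem (this.2 hτ)]
  · rw [indicator_of_notMem hτ, indicator_of_notMem (fun h => hτ (this.1 h))]

/-- The fractional integral of `exp` over the whole past is `exp` itself, by Euler's integral for
`Γ(α)`; starting at time 0 only decreases it. -/
theorem exists_of_eq_one (n : ℕ) {p α : ℝ} (hp : 1 ≤ p) (hα : 0 < α) :
    ∃ u : SpaceTime n → ℝ, IsNonnegSuperSolution n p α 1 u ∧ ¬ ∀ᵐ z, u z = 0 := by
  have hΓ := Real.Gamma_pos_of_pos hα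
  refine exists_of_profile n hp hα one_pos (h := Real.exp) (H := Real.exp) Real.measurable_exp
    (fun t _ => Real.exp_pos t) (fun T => ⟨Real.exp T, fun t _ ht => Real.exp_le_exp.2 ht.le⟩)
    (fun t ht => ⟨(Real.exp_pos t).le, ?_⟩) (fun t ht x => by rw [Real.rpow_one, mul_comm])
  have e : ∀ τ, ENNReal.ofReal ((t - τ) ^ (α - 1) / Real.Gamma α * Real.exp τ) =
      (fun s => ENNReal.ofReal (Real.exp t / Real.Gamma α * (Real.exp (-s) * s ^ (α - 1))))
        (t - τ) := by
    intro τ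
    have : Real.exp τ = Real.exp t * Real.exp (-(t - τ)) := by
      rw [← Real.exp_add]
      congr 1
      ring
    simp only [this]
    congr 1
    ring
  simp_rw [e]
  rw [setLIntegral_Ioo_reflect t
    (fun s => ENNReal.ofReal (Real.exp t / Real.Gamma α * (Real.exp (-s) * s ^ (α - 1))))]
  refine (lintegral_mono_set Ioo_subset_Ioi_self).trans ?_
  simp_rw [ENNReal.ofReal_mul (show 0 ≤ Real.exp t / Real.Gamma α by positivity)]
  rw [lintegral_const_mul' _ _ ENNReal.ofReal_ne_top,
    ← ofReal_integral_eq_lintegral_ofReal (Real.GammaIntegral_convergent hα)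
      ((ae_restrict_iff' measurableSet_Ioi).2 (.of_forall fun s hs =>
        mul_nonneg (Real.exp_pos _).le (Real.rpow_nonneg (le_of_lt hs) _))),
    ← Real.Gamma_eq_integral hα, ← ENNReal.ofReal_mul (by positivity),
    div_mul_cancel₀ _ hΓ.ne']

lemma setLIntegral_rpow {α t : ℝ} (hα : 0 < α) (ht : 0 < t) :
    ∫⁻ s in Ioo 0 t, ENNReal.ofReal (s ^ (α - 1)) = ENNReal.ofReal (t ^ α / α) := by
  have hint : IntegrableOn (fun s : ℝ => s ^ (α - 1)) (Ioc 0 t) :=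
    (intervalIntegrable_iff_integrableOn_Ioc_of_le ht.le).1
      (intervalIntegral.intervalIntegrable_rpow' (by linarith))
  rw [setLIntegral_congr Ioo_ae_eq_Ioc, ← ofReal_integral_eq_lintegral_ofReal hint
    ((ae_restrict_iff' measurableSet_Ioc).2 (.of_forall fun s hs => Real.rpow_nonneg hs.1.le _)),
    ← intervalIntegral.integral_of_le ht.le, integral_rpow (Or.inl (by linarith)),
    sub_add_cancel, Real.zero_rpow hα.ne', sub_zero]

/-- The fractional integral of order `α` of `(1 + τ)^(-γ)`, `γ > 1`, is `O((1 + t)^(α-1))`. -/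
lemma fracIntegral_bound {α γ : ℝ} (hα : 0 < α) (hγ : 1 < γ) :
    ∃ C, 0 < C ∧ ∀ t, 0 < t →
      ∫⁻ τ in Ioo 0 t, ENNReal.ofReal ((t - τ) ^ (α - 1) / Real.Gamma α * (1 + τ) ^ (-γ)) ≤
        ENNReal.ofReal (C * (1 + t) ^ (α - 1)) := by
  have hΓ := Real.Gamma_pos_of_pos hα
  have hint : IntegrableOn (fun τ : ℝ => (1 + τ) ^ (-γ)) (Ioi 0) := by
    simpa only [add_comm] using
      integrableOn_add_rpow_Ioi_of_lt (m := 1) (c := 0) (neg_lt_neg hγ) (by norm_num)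
  set I : ℝ := ∫ τ in Ioi (0 : ℝ), (1 + τ) ^ (-γ) with hI
  have hnn : ∀ τ ∈ Ioi (0 : ℝ), 0 ≤ (1 + τ) ^ (-γ) := fun τ hτ =>
    Real.rpow_nonneg (by linarith [mem_Ioi.1 hτ]) _
  have hI0 : 0 ≤ I := setIntegral_nonneg measurableSet_Ioi hnn
  set A : ℝ := (1 + 2 ^ (1 - α)) / Real.Gamma α with hA
  set B : ℝ := 2 ^ γ / Real.Gamma α with hB
  have hA0 : 0 < A := by positivity
  have hB0 : 0 < B := by positivity
  refine ⟨A * I + B / α, by positivity, fun t ht => ?_⟩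
  have hT : 0 < 1 + t := by linarith
  have hpt : ∀ τ ∈ Ioo 0 t, (t - τ) ^ (α - 1) / Real.Gamma α * (1 + τ) ^ (-γ) ≤
      A * (1 + t) ^ (α - 1) * (1 + τ) ^ (-γ) + B * (1 + t)⁻¹ * (t - τ) ^ (α - 1) := by
    rintro τ ⟨h0, h1⟩
    have hs : 0 < t - τ := by linarith
    have hτ : 0 < 1 + τ := by linarith
    -- Far from `t` the kernel is at most a constant times `(1+t)^(α-1)`, the two summands of `1 +
    -- 2^(1-α)` serving `α ≥ 1` and `α ≤ 1`, and `γ > 1` gives integrability. Near `t` one has `1 +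
    -- τ ≥ (1+t)/2`.
    rcases le_total ((1 + t) / 2) (t - τ) with h | h
    · have key : (t - τ) ^ (α - 1) ≤ (1 + 2 ^ (1 - α)) * (1 + t) ^ (α - 1) := by
        have hT' : 0 < (1 + t) ^ (α - 1) := by positivity
        have h2 : (0 : ℝ) < 2 ^ (1 - α) := by positivity
        rcases le_total 1 α with h3 | h3
        · have : (t - τ) ^ (α - 1) ≤ (1 + t) ^ (α - 1) :=
            Real.rpow_le_rpow hs.le (by linarith) (by linarith)
          nlinarith
        · have : (t - τ) ^ (α - 1) ≤ ((1 + t) / 2) ^ (α - 1) :=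
            Real.rpow_le_rpow_of_nonpos (by positivity) h (by linarith)
          rw [Real.div_rpow hT.le (by norm_num), div_eq_mul_inv, ← Real.rpow_neg (by norm_num),
            neg_sub] at this
          nlinarith
      calc (t - τ) ^ (α - 1) / Real.Gamma α * (1 + τ) ^ (-γ)
          ≤ (1 + 2 ^ (1 - α)) * (1 + t) ^ (α - 1) / Real.Gamma α * (1 + τ) ^ (-γ) := by gcongr
        _ = A * (1 + t) ^ (α - 1) * (1 + τ) ^ (-γ) := by rw [hA]; ring
        _ ≤ _ := le_add_of_nonneg_right (by positivity)
    · have key : (1 + τ) ^ (-γ) ≤ 2 ^ γ * (1 + t)⁻¹ := by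
        calc (1 + τ) ^ (-γ) ≤ ((1 + t) / 2) ^ (-γ) :=
              Real.rpow_le_rpow_of_nonpos (by positivity) (by linarith) (by linarith)
          _ = 2 ^ γ * (1 + t) ^ (-γ) := by
              rw [Real.div_rpow hT.le (by norm_num), Real.rpow_neg (by norm_num : (0 : ℝ) ≤ 2) γ,
                div_inv_eq_mul, mul_comm]
          _ ≤ 2 ^ γ * (1 + t) ^ (-1 : ℝ) := by
              gcongr
              linarith
          _ = _ := by rw [Real.rpow_neg_one]
      calc (t - τ) ^ (α - 1) / Real.Gamma α * (1 + τ) ^ (-γ)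
          ≤ (t - τ) ^ (α - 1) / Real.Gamma α * (2 ^ γ * (1 + t)⁻¹) := by gcongr
        _ = B * (1 + t)⁻¹ * (t - τ) ^ (α - 1) := by rw [hB]; ring
        _ ≤ _ := le_add_of_nonneg_left (by positivity)
  have hI' : ∫⁻ τ in Ioo 0 t, ENNReal.ofReal ((1 + τ) ^ (-γ)) ≤ ENNReal.ofReal I := by
    rw [hI, ofReal_integral_eq_lintegral_ofReal hint
      ((ae_restrict_iff' measurableSet_Ioi).2 (.of_forall hnn))]
    exact lintegral_mono_set Ioo_subset_Ioi_self
  have hK : ∫⁻ τ in Ioo 0 t, ENNReal.ofReal ((t - τ) ^ (α - 1)) ≤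
      ENNReal.ofReal ((1 + t) ^ α / α) := by
    rw [setLIntegral_Ioo_reflect t (fun s => ENNReal.ofReal (s ^ (α - 1))),
      setLIntegral_rpow hα ht]
    gcongr
    linarith
  calc ∫⁻ τ in Ioo 0 t, ENNReal.ofReal ((t - τ) ^ (α - 1) / Real.Gamma α * (1 + τ) ^ (-γ))
      ≤ ∫⁻ τ in Ioo 0 t, (ENNReal.ofReal (A * (1 + t) ^ (α - 1)) *
          ENNReal.ofReal ((1 + τ) ^ (-γ)) +
          ENNReal.ofReal (B * (1 + t)⁻¹) * ENNReal.ofReal ((t - τ) ^ (α - 1))) := by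
        refine lintegral_mono_ae ((ae_restrict_iff' measurableSet_Ioo).2
          (.of_forall fun τ hτ => ?_))
        rw [← ENNReal.ofReal_mul (by positivity), ← ENNReal.ofReal_mul (by positivity)]
        exact (ENNReal.ofReal_le_ofReal (hpt τ hτ)).trans ENNReal.ofReal_add_le
    _ = ENNReal.ofReal (A * (1 + t) ^ (α - 1)) *
          (∫⁻ τ in Ioo 0 t, ENNReal.ofReal ((1 + τ) ^ (-γ))) +
        ENNReal.ofReal (B * (1 + t)⁻¹) *
          ∫⁻ τ in Ioo 0 t, ENNReal.ofReal ((t - τ) ^ (α - 1)) := by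
        rw [lintegral_add_left (by fun_prop), lintegral_const_mul' _ _ ENNReal.ofReal_ne_top,
          lintegral_const_mul' _ _ ENNReal.ofReal_ne_top]
    _ ≤ ENNReal.ofReal (A * (1 + t) ^ (α - 1)) * ENNReal.ofReal I +
        ENNReal.ofReal (B * (1 + t)⁻¹) * ENNReal.ofReal ((1 + t) ^ α / α) := by gcongr
    _ = ENNReal.ofReal ((A * I + B / α) * (1 + t) ^ (α - 1)) := by
        rw [← ENNReal.ofReal_mul (by positivity), ← ENNReal.ofReal_mul (by positivity),
          ← ENNReal.ofReal_add (by positivity) (by positivity), Real.rpow_sub_one hT.ne']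
        congr 1
        field_simp

/-- The exponent `γ` balances the decay of `G^(lam-1)` and of `(1+t)^((α-1) lam)`; `γ > 1` is
exactly `hsub`. The constant `ε` is fixed by homogeneity, `ε^(lam-1) C^lam = 1`. -/
theorem exists_of_one_lt (n : ℕ) {p α lam : ℝ} (hp : 1 ≤ p) (hα : 0 < α) (hlam : 1 < lam)
    (hsub : 2 * α * lam < ((n : ℝ) + 2) * (lam - 1)) :
    ∃ u : SpaceTime n → ℝ, IsNonnegSuperSolution n p α lam u ∧ ¬ ∀ᵐ z, u z = 0 := by
  have hl0 : 0 < lam := by linarith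
  have hl1 : 0 < lam - 1 := by linarith
  set γ : ℝ := (n : ℝ) * (lam - 1) / 2 + lam * (1 - α) with hγ
  have hγ1 : 1 < γ := by linarith
  obtain ⟨C, hC, hbound⟩ := fracIntegral_bound hα hγ1
  set ε : ℝ := C ^ (-(lam / (lam - 1))) with hε
  have hε0 : 0 < ε := by positivity
  have hεC : ε ^ (lam - 1) * C ^ lam = 1 := by
    rw [hε, ← Real.rpow_mul hC.le, ← Real.rpow_add hC]
    rw [show -(lam / (lam - 1)) * (lam - 1) + lam = 0 by field_simp; ring, Real.rpow_zero]
  refine exists_of_profile n hp hα hl0 (h := fun t => ε * (1 + t) ^ (-γ))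
    (H := fun t => ε * (C * (1 + t) ^ (α - 1))) (by fun_prop)
    (fun t ht => by positivity) (fun T => ⟨ε, fun t ht _ => ?_⟩)
    (fun t ht => ⟨by positivity, ?_⟩) (fun t ht x => ?_)
  · exact mul_le_of_le_one_right hε0.le
      (Real.rpow_le_one_of_one_le_of_nonpos (by linarith) (by linarith))
  · simp_rw [mul_left_comm _ ε, ENNReal.ofReal_mul hε0.le]
    rw [lintegral_const_mul' _ _ ENNReal.ofReal_ne_top]
    gcongr
    exact hbound t ht
  · have hT : 0 < 1 + t := by linarith
    rw [add_comm t 1]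
    set G := heatKernel n x (1 + t) with hG
    have hG0 : 0 < G := heatKernel_pos n x hT
    have hG1 : G ^ (lam - 1) ≤ (1 + t) ^ (-((n : ℝ) / 2) * (lam - 1)) := by
      rw [Real.rpow_mul hT.le]
      exact Real.rpow_le_rpow hG0.le (heatKernel_le n x hT) hl1.le
    have split : ∀ y : ℝ, 0 < y → y ^ lam = y ^ (lam - 1) * y := fun y hy => by
      rw [← Real.rpow_add_one hy.ne', sub_add_cancel]
    calc (G * (ε * (C * (1 + t) ^ (α - 1)))) ^ lam
        = (ε ^ (lam - 1) * C ^ lam) * ε * G * G ^ (lam - 1) * (1 + t) ^ ((α - 1) * lam) := by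
          rw [Real.mul_rpow hG0.le (by positivity), Real.mul_rpow hε0.le (by positivity),
            Real.mul_rpow hC.le (by positivity), ← Real.rpow_mul hT.le, split G hG0, split ε hε0]
          ring
      _ ≤ (ε ^ (lam - 1) * C ^ lam) * ε * G * (1 + t) ^ (-((n : ℝ) / 2) * (lam - 1)) *
          (1 + t) ^ ((α - 1) * lam) := by gcongr
      _ = ε * (1 + t) ^ (-γ) * G := by
          have : -γ = -((n : ℝ) / 2) * (lam - 1) + (α - 1) * lam := by rw [hγ]; ring
          rw [hεC, this, Real.rpow_add hT]
          ring

/-! ### Admissibility and the regions -/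

lemma Admissible.one_le {n : ℕ} {p α : ℝ} (h : Admissible n p α) : 1 ≤ p := by
  rcases h with h | h
  · exact h.1.le
  · exact h.1.ge

lemma Admissible.pos {n : ℕ} {p α : ℝ} (h : Admissible n p α) : 0 < α := by
  rcases h with h | h
  · exact h.2.1
  · exact h.2.1

lemma Admissible.le_half {n : ℕ} {p α : ℝ} (h : Admissible n p α) : α ≤ ((n : ℝ) + 2) / 2 := by
  have hp := h.one_le
  have h1 : α ≤ ((n : ℝ) + 2) / (2 * p) := by
    rcases h with h | h
    · exact h.2.2.le
    · exact h.2.2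
  exact h1.trans (div_le_div_of_nonneg_left (by positivity) (by norm_num) (by linarith))

/-- For `p ≥ 1` the union of the regions is cut out by the critical curve alone. -/
lemma mem_regions_iff {n : ℕ} {p α lam : ℝ} (hp : 1 ≤ p) (hα : 0 < α) :
    (lam, α) ∈ regionB ∪ regionD n p ∪ regionE n p ↔
      lam = 1 ∨ (1 < lam ∧ 2 * α * lam < ((n : ℝ) + 2) * (lam - 1)) := by
  have key : 1 < lam → (α < ((n : ℝ) + 2) / 2 * (1 - 1 / lam) ↔
      2 * α * lam < ((n : ℝ) + 2) * (lam - 1)) := by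
    intro hl
    have hl0 : 0 < lam := by linarith
    rw [show ((n : ℝ) + 2) / 2 * (1 - 1 / lam) = ((n : ℝ) + 2) * (lam - 1) / (2 * lam) by
      field_simp, lt_div_iff₀ (by positivity)]
    constructor <;> intro h <;> linarith
  have hle : 1 < lam → ((n : ℝ) + 2) / (2 * p) * (1 - 1 / lam) ≤
      ((n : ℝ) + 2) / 2 * (1 - 1 / lam) := by
    intro hl
    have : 0 ≤ 1 - 1 / lam := by
      rw [sub_nonneg, div_le_one (by linarith)]
      exact hl.le
    gcongr
    linarith
  simp only [mem_union, regionB, regionD, regionE, mem_ofPred_eq]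
  constructor
  · rintro ((⟨h, -⟩ | ⟨h1, -, h2⟩) | ⟨h1, -, h2⟩)
    · exact Or.inl h
    · exact Or.inr ⟨h1, (key h1).1 h2⟩
    · exact Or.inr ⟨h1, (key h1).1 (h2.trans_le (hle h1))⟩
  · rintro (h | ⟨h1, h2⟩)
    · exact Or.inl (Or.inl ⟨h, hα⟩)
    · rcases le_or_gt (((n : ℝ) + 2) / (2 * p) * (1 - 1 / lam)) α with h3 | h3
      · exact Or.inl (Or.inr ⟨h1, h3, (key h1).2 h2⟩)
      · exact Or.inr ⟨h1, hα, h3⟩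

end FracHeat

theorem theorem1p1 (n : ℕ) (hn : 1 ≤ n) (p α lam : ℝ)
    (hap : FracHeat.Admissible n p α) (hlam : 0 < lam) :
    (∃ u : FracHeat.SpaceTime n → ℝ,
        FracHeat.IsNonnegSuperSolution n p α lam u ∧
          ¬ (∀ᵐ z : FracHeat.SpaceTime n, u z = 0)) ↔
      (lam, α) ∈ FracHeat.regionB ∪ FracHeat.regionD n p ∪ FracHeat.regionE n p := by
  rw [FracHeat.mem_regions_iff hap.one_le hap.pos]
  constructor
  · rintro ⟨u, hu, hu0⟩
    exact FracHeat.necessary hn hap.one_le hap.pos hap.le_half hlam hu hu0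
  · rintro (rfl | ⟨h1, h2⟩)
    · exact FracHeat.exists_of_eq_one n hap.one_le hap.pos
    · exact FracHeat.exists_of_one_lt n hap.one_le hap.pos h1 h2
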